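/- **Theorem.** Let $n\ge 0$ and let $B_n$ be the group of permutations $\sigma$ of $\{\pm1,\dots,\pm n\}$ with $\sigma(-k)=-\sigma(k)$ for all $k$, with simple generators $s_0,\dots,s_{n-1}$, where $s_0$ exchanges $1$ and $-1$, and $s_i$ ($i\ge1$) exchanges $i$ with $i+1$ and $-i$ with $-(i+1)$. Let $\ell$ be the word length with respect to these generators, and let $\mathrm{Des}(w)=\{i\in\{0,\dots,n-1\}:\ell(s_iw)<\ell(w)\}$. Write $x\le_{\mathsf L}y$ (left weak order) if some reduced word for $y$ has a reduced word for $x$ as a suffix, and write $[x,y]_{\mathsf L}=\{z: x\le_{\mathsf L}z\le_{\mathsf L}y\}$. A set $X\subseteq B_n$ is *ascent-compatible* if for all $u,v\in X$ and all $i\notin\mathrm{Des}(u)$, $j\notin\mathrm{Des}(v)$ with $u^{-1}s_iu=v^{-1}s_jv$, one has $s_iu\in X$ if and only if $s_jv\in X$. Let $H_n^B(0)$ be the $\mathbb C$-algebra generated by $\pi_0,\dots,\pi_{n-1}$ with relations $\pi_i^2=-\pi_i$; $\pi_i\pi_j=\pi_j\pi_i$ for $|i-j|\ge2$; $\pi_i\pi_{i+1}\pi_i=\pi_{i+1}\pi_i\pi_{i+1}$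 for $i\ge1$; and $\pi_0\pi_1\pi_0\pi_1=\pi_1\pi_0\pi_1\pi_0$. For $I\subseteq\{0,\dots,n-1\}$ let $\mathcal S_I^B$ be the one-dimensional $H_n^B(0)$-module on which $\pi_j$ acts as $-1$ if $j\in I$ and as $0$ if $j\notin I$, and let $$F_I^B=\sum_{\substack{0=i_0\le i_1\le\cdots\le i_n\\ j\in I\Rightarrow i_j<i_{j+1}}}x_{i_1}x_{i_2}\cdots x_{i_n}.$$ Let $\mathrm{ch}^B$ be the homomorphism on the Grothendieck group of finite-dimensional (equivalently, finitely generated) $H_n^B(0)$-modules with $\mathrm{ch}^B([\mathcal S_I^B])=F_I^B$ for all $I$, and write $\mathrm{ch}^B(M)=\mathrm{ch}^B([M])$. For $X\subseteq B_n$ put $\mathcal Q(X)=\sum_{x\in X}F^B_{\mathrm{Des}(x^{-1})}$ and $X^{-1}=\{x^{-1}:x\in X\}$, let $\mathbb CX$ be the complex vector space with basis $X$, and for $x\in X$ put $\pi_i(x)=-x$ if $i\in\mathrm{Des}(x)$, $\pi_i(x)=s_ix$ if $i\notin\mathrm{Des}(x)$ and $s_ix\in X$, and $\pi_i(x)=0$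 otherwise. For $I\subseteq\{0,\dots,n-1\}$ let $D_I^B=\{\sigma\in B_n:\mathrm{Des}(\sigma)=I\}$. For $1\le i\le n$ let $L_i^B$ be the set of all $\sigma\in B_n$ with $\sigma^{-1}(1)>\cdots>\sigma^{-1}(i)<\cdots<\sigma^{-1}(n)$, and let $L^B=\bigcup_{i=1}^nL_i^B$. Then: 1. For every $I\subseteq\{0,\dots,n-1\}$ the set $(D_I^B)^{-1}$ is ascent-compatible, and for every $1\le i\le n$ the set $(L_i^B)^{-1}$ is ascent-compatible. 2. For every $1\le i\le n$ there are elements $\tau\le_{\mathsf L}\sigma$ of $B_n$ given by $\tau(j)=i+1-j$ for $1\le j\le i$ and $\tau(k)=k$ for $i<k\le n$, and by $\sigma(j)=-j$ for $1\le j\le i-1$ and $\sigma(k)=k-i-n$ for $i\le k\le n$, and $(L_i^B)^{-1}=[\tau,\sigma]_{\mathsf L}$. 3. The operators $\pi_0,\dots,\pi_{n-1}$ define $H_n^B(0)$-module structures on $\mathbb C(D_I^B)^{-1}$ and on $\mathbb C(L_i^B)^{-1}$, and for these $$\mathrm{ch}^B\big(\mathbb C(D_I^B)^{-1}\big)=\mathcal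 Q(D_I^B),\qquad \mathrm{ch}^B\big(\mathbb C(L_i^B)^{-1}\big)=\mathcal Q(L_i^B),\qquad \mathrm{ch}^B\Big(\bigoplus_{i=1}^n\mathbb C(L_i^B)^{-1}\Big)=\mathcal Q(L^B).$$ -/

import Mathlib

open scoped Pointwise DirectSum

/-! ### Words, length, descents and left weak order of a group with a family of generators -/

section Generators

variable {ι G : Type*} [Group G] (s : ι → G)

/-- The group element represented by a word in the generators. -/
def wordProd (ω : List ι) : G := (ω.map s).prod

/-- `ω` is a reduced word for `w`: a word of minimum length representing `w`. -/
def IsReducedWord (ω : List ι) (w : G) : Prop :=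
  wordProd s ω = w ∧ ∀ ω' : List ι, wordProd s ω' = w → ω.length ≤ ω'.length

/-- The length of `w`: the number of letters in a reduced word for `w`. -/
noncomputable def wordLength (w : G) : ℕ :=
  sInf {k | ∃ ω : List ι, wordProd s ω = w ∧ ω.length = k}

/-- The set of (left) descents of `w`, as a set of indices of generators. -/
def Des (w : G) : Set ι := {i | wordLength s (s i * w) < wordLength s w}

/-- The left descent class of a set `I` of generators. -/
def descentClass (I : Set ι) : Set G := {w | Des s w = I}

/-- The quadruple `(u, v, s i, s j)` is aligned. -/
def Aligned (u v : G) (i j : ι) : Prop :=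
  i ∉ Des s u ∧ j ∉ Des s v ∧ u⁻¹ * s i * u = v⁻¹ * s j * v

/-- Ascent-compatible subsets. -/
def AscentCompatible (X : Set G) : Prop :=
  ∀ u ∈ X, ∀ v ∈ X, ∀ i j : ι, Aligned s u v i j → (s i * u ∈ X ↔ s j * v ∈ X)

/-- The left weak order: some reduced word for `y` has a reduced word for `x` as a suffix. -/
def LeftWeakLE (x y : G) : Prop :=
  ∃ ωx ωy : List ι, IsReducedWord s ωx x ∧ IsReducedWord s ωy y ∧ ωx <:+ ωy

/-- The interval between `x` and `y` in the left weak order. -/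
def leftInterval (x y : G) : Set G := {z | LeftWeakLE s x z ∧ LeftWeakLE s z y}

open Classical in
/-- The operator `π_i` on the complex vector space `ℂX` freely generated by `X`. -/
noncomputable def piOp (X : Set G) (i : ι) : (X →₀ ℂ) →ₗ[ℂ] (X →₀ ℂ) :=
  Finsupp.linearCombination ℂ fun x : X =>
    if i ∈ Des s (x : G) then -Finsupp.single x 1
    else if h : s i * (x : G) ∈ X then Finsupp.single ⟨s i * (x : G), h⟩ 1
    else 0

end Generators

/-! ### The hyperoctahedral group -/

/-- The set `±[n] = {±1, …, ±n}`. -/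
abbrev SignedSet (n : ℕ) : Type := {k : ℤ // k ∈ (Finset.Icc (-(n : ℤ)) n).erase 0}

instance (n : ℕ) : Neg (SignedSet n) :=
  ⟨fun k => ⟨-k.1, by
    have h := k.2
    simp only [Finset.mem_erase, Finset.mem_Icc] at h ⊢
    omega⟩⟩

@[simp] theorem SignedSet.coe_neg {n : ℕ} (k : SignedSet n) : ((-k : SignedSet n) : ℤ) = -(k : ℤ) :=
  rfl

instance (n : ℕ) : InvolutiveNeg (SignedSet n) :=
  ⟨fun k => Subtype.ext (by simp)⟩

/-- The element `j + 1` of `±[n]`; the index `j : Fin n` runs over `0, …, n - 1`. -/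
def pos {n : ℕ} (j : Fin n) : SignedSet n :=
  ⟨(j : ℤ) + 1, by
    have := j.2
    simp only [Finset.mem_erase, Finset.mem_Icc]
    omega⟩

/-- The hyperoctahedral group: permutations `σ` of `±[n]` with `σ (-k) = -σ k`. -/
def hyperoctahedral (n : ℕ) : Subgroup (Equiv.Perm (SignedSet n)) where
  carrier := {σ | ∀ k, σ (-k) = -σ k}
  mul_mem' := fun {σ τ} hσ hτ k => by
    rw [Equiv.Perm.mul_apply, Equiv.Perm.mul_apply, hτ k, hσ]
  one_mem' := fun _ => rfl
  inv_mem' := fun {σ} hσ k => by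
    rw [Equiv.Perm.inv_eq_iff_eq, hσ, ← Equiv.Perm.mul_apply, mul_inv_cancel, Equiv.Perm.one_apply]

/-- The group `B_n`. -/
abbrev BGroup (n : ℕ) : Type := hyperoctahedral n

theorem swap_neg_apply {n : ℕ} (a b k : SignedSet n) :
    Equiv.swap (-a) (-b) (-k) = -Equiv.swap a b k := by
  simp only [Equiv.swap_apply_def, neg_inj]
  split_ifs <;> rfl

/-- The simple generators of `B_n`, indexed by `0, …, n - 1`: `s_0` exchanges `1` and `-1`, and for
`i ≥ 1` the generator `s_i` exchanges `i` with `i + 1` and `-i` with `-(i + 1)`. -/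
def simpleB (n : ℕ) (i : Fin n) : BGroup n :=
  if h : (i : ℕ) = 0 then
    ⟨Equiv.swap (pos i) (-pos i), fun k => by
      have := swap_neg_apply (pos i) (-pos i) k
      rwa [neg_neg, Equiv.swap_comm] at this⟩
  else
    ⟨Equiv.swap (pos ⟨i - 1, by omega⟩) (pos i) * Equiv.swap (-pos ⟨i - 1, by omega⟩) (-pos i),
      fun k => by
        set a : SignedSet n := pos ⟨i - 1, by omega⟩ with ha
        set b : SignedSet n := pos i with hb
        have hva : (a : ℤ) = i := by simp only [ha, pos]; omega
        have hvb : (b : ℤ) = i + 1 := by simp only [hb, pos]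
        have hcomm : Commute (Equiv.swap a b) (Equiv.swap (-a) (-b)) := by
          refine (Equiv.Perm.disjoint_iff_disjoint_support.2 ?_).commute
          have h1 : a ≠ b := fun e => by have := congrArg Subtype.val e; omega
          have h2 : -a ≠ -b := fun e => h1 (neg_inj.1 e)
          rw [Equiv.Perm.support_swap h1, Equiv.Perm.support_swap h2]
          simp only [Finset.disjoint_left, Finset.mem_insert, Finset.mem_singleton]
          rintro x (rfl | rfl) (e | e) <;>
          · have := congrArg Subtype.val e
            simp only [SignedSet.coe_neg] at this
            omega
        rw [hcomm.eq, Equiv.Perm.mul_apply, ← hcomm.eq, Equiv.Perm.mul_apply]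
        have h3 := swap_neg_apply (-a) (-b) k
        rw [neg_neg, neg_neg] at h3
        rw [h3, swap_neg_apply, ← Equiv.Perm.mul_apply]⟩

/-- The class `L_i^B` of all `σ` with `σ⁻¹(1) > ⋯ > σ⁻¹(i) < ⋯ < σ⁻¹(n)`; the index `i : Fin n` here
stands for the position `i + 1`. -/
def leftUnimodalClass (n : ℕ) (i : Fin n) : Set (BGroup n) :=
  {σ | StrictAntiOn (fun j : Fin n => ((σ⁻¹ : BGroup n).1 (pos j) : ℤ)) (Set.Iic i) ∧
    StrictMonoOn (fun j : Fin n => ((σ⁻¹ : BGroup n).1 (pos j) : ℤ)) (Set.Ici i)}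

/-- The set `L^B` of left-unimodal permutations. -/
def leftUnimodal (n : ℕ) : Set (BGroup n) := ⋃ i : Fin n, leftUnimodalClass n i

/-! ### Type-B quasisymmetric functions -/

/-- The type-B fundamental quasisymmetric function `F_I^B` in the variables `x_0, x_1, …`, for
`I ⊆ [0, n - 1]`: the sum of `x_{f 1} ⋯ x_{f n}` over all `0 = f 0 ≤ f 1 ≤ ⋯ ≤ f n` such that
`f j < f (j + 1)` for all `j ∈ I`. The coefficient of a monomial is the number of such sequences
producing it. -/
noncomputable def fundB (n : ℕ) (I : Set (Fin n)) : MvPowerSeries ℕ ℂ := fun m =>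
  (Nat.card {f : Fin (n + 1) → ℕ // f 0 = 0 ∧ Monotone f ∧
    (∀ j ∈ I, f j.castSucc < f j.succ) ∧ ∑ j : Fin n, Finsupp.single (f j.succ) 1 = m} : ℂ)

/-- `𝒬(X)`, the sum of `F^B` at the descent sets of the inverses of the elements of `X`. -/
noncomputable def QB (n : ℕ) (X : Set (BGroup n)) : MvPowerSeries ℕ ℂ :=
  ∑ᶠ x ∈ X, fundB n (Des (simpleB n) x⁻¹)

/-! ### The type-B 0-Hecke algebra and its simple modules -/

/-- The defining relations of the type-B 0-Hecke algebra. -/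
inductive HeckeBRel (n : ℕ) : FreeAlgebra ℂ (Fin n) → FreeAlgebra ℂ (Fin n) → Prop
  | sq (i : Fin n) : HeckeBRel n (FreeAlgebra.ι ℂ i * FreeAlgebra.ι ℂ i) (-FreeAlgebra.ι ℂ i)
  | comm (i j : Fin n) (h : (i : ℕ) + 2 ≤ j) :
      HeckeBRel n (FreeAlgebra.ι ℂ i * FreeAlgebra.ι ℂ j) (FreeAlgebra.ι ℂ j * FreeAlgebra.ι ℂ i)
  | braid (i j : Fin n) (hi : 1 ≤ (i : ℕ)) (h : (j : ℕ) = i + 1) :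
      HeckeBRel n (FreeAlgebra.ι ℂ i * FreeAlgebra.ι ℂ j * FreeAlgebra.ι ℂ i)
        (FreeAlgebra.ι ℂ j * FreeAlgebra.ι ℂ i * FreeAlgebra.ι ℂ j)
  | braid_zero (i j : Fin n) (hi : (i : ℕ) = 0) (hj : (j : ℕ) = 1) :
      HeckeBRel n
        (FreeAlgebra.ι ℂ i * FreeAlgebra.ι ℂ j * FreeAlgebra.ι ℂ i * FreeAlgebra.ι ℂ j)
        (FreeAlgebra.ι ℂ j * FreeAlgebra.ι ℂ i * FreeAlgebra.ι ℂ j * FreeAlgebra.ι ℂ i)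

/-- The type-B 0-Hecke algebra `H_n^B(0)` over `ℂ`. -/
abbrev HeckeB (n : ℕ) : Type := RingQuot (HeckeBRel n)

/-- The generator `π_i` of `H_n^B(0)`. -/
noncomputable def heckePi (n : ℕ) (i : Fin n) : HeckeB n :=
  RingQuot.mkAlgHom ℂ (HeckeBRel n) (FreeAlgebra.ι ℂ i)

open Classical in
/-- The character of `H_n^B(0)` sending `π_j` to `-1` if `j ∈ I` and to `0` otherwise. -/
noncomputable def heckeChar (n : ℕ) (I : Set (Fin n)) : HeckeB n →ₐ[ℂ] ℂ :=
  RingQuot.liftAlgHom ℂ ⟨FreeAlgebra.lift ℂ fun j => if j ∈ I then (-1 : ℂ) else 0, by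
    intro x y h
    induction h with
    | sq i => by_cases hi : i ∈ I <;> simp [hi]
    | comm i j h => simp only [map_mul]; ring
    | braid i j hi h =>
        by_cases hi : i ∈ I <;> by_cases hj : j ∈ I <;> simp [hi, hj]
    | braid_zero i j hi hj => simp only [map_mul]; ring⟩

open Classical in
theorem heckeChar_pi (n : ℕ) (I : Set (Fin n)) (j : Fin n) :
    heckeChar n I (heckePi n j) = if j ∈ I then (-1 : ℂ) else 0 := by
  simp [heckeChar, heckePi, RingQuot.liftAlgHom_mkAlgHom_apply]

/-- The underlying space of the one-dimensional simple module `𝒮_I^B`. -/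
def SimpleMod (n : ℕ) (_ : Set (Fin n)) : Type := ℂ

namespace SimpleMod

variable (n : ℕ) (I : Set (Fin n))

noncomputable instance : AddCommGroup (SimpleMod n I) := inferInstanceAs (AddCommGroup ℂ)

noncomputable instance : Module ℂ (SimpleMod n I) := inferInstanceAs (Module ℂ ℂ)

instance : Module.Finite ℂ (SimpleMod n I) := inferInstanceAs (Module.Finite ℂ ℂ)

/-- `H_n^B(0)` acts on `𝒮_I^B` through the character of `I`. -/
noncomputable instance : Module (HeckeB n) (SimpleMod n I) :=
  Module.compHom ℂ (heckeChar n I).toRingHom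

theorem smul_def (h : HeckeB n) (v : SimpleMod n I) :
    h • v = heckeChar n I h • v := rfl

instance : IsScalarTower ℂ (HeckeB n) (SimpleMod n I) :=
  ⟨fun c h v => by rw [smul_def, smul_def, map_smul, smul_assoc]⟩

end SimpleMod

/-! ### The Grothendieck group and the type-B quasisymmetric characteristic -/

/-- Finite-dimensional `H_n^B(0)`-modules. As `H_n^B(0)` is a finite-dimensional algebra, these are
its finitely generated modules. -/
structure HeckeMod (n : ℕ) where
  /-- the underlying space -/
  carrier : Type
  [addCommGroup : AddCommGroup carrier]
  [moduleC : Module ℂ carrier]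
  [moduleH : Module (HeckeB n) carrier]
  [isScalarTower : IsScalarTower ℂ (HeckeB n) carrier]
  [finite : Module.Finite ℂ carrier]

attribute [instance] HeckeMod.addCommGroup HeckeMod.moduleC HeckeMod.moduleH
  HeckeMod.isScalarTower HeckeMod.finite

/-- The relations `[A] - [B] + [C]`, one for every short exact sequence `0 → A → B → C → 0` of
`H_n^B(0)`-modules. They identify isomorphic modules, so the classes of modules may be taken in
place of isomorphism classes. -/
def grothendieckRelations (n : ℕ) : Set (FreeAbelianGroup (HeckeMod n)) :=
  {r | ∃ (A B C : HeckeMod n) (f : A.carrier →ₗ[HeckeB n] B.carrier)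
      (g : B.carrier →ₗ[HeckeB n] C.carrier),
      Function.Injective f ∧ Function.Exact f g ∧ Function.Surjective g ∧
      r = FreeAbelianGroup.of A - FreeAbelianGroup.of B + FreeAbelianGroup.of C}

/-- The Grothendieck group `𝒢₀(H_n^B(0))`. -/
abbrev GrothendieckB (n : ℕ) : Type 1 :=
  FreeAbelianGroup (HeckeMod n) ⧸ AddSubgroup.closure (grothendieckRelations n)

/-- The class `[M]` in the Grothendieck group. -/
def grothendieckClass (n : ℕ) (M : Type) [AddCommGroup M] [Module ℂ M] [Module (HeckeB n) M]
    [IsScalarTower ℂ (HeckeB n) M] [Module.Finite ℂ M] : GrothendieckB n :=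
  QuotientAddGroup.mk (FreeAbelianGroup.of (HeckeMod.mk M))

/-- The trace of an endomorphism of a short exact sequence of finite-dimensional spaces is
additive. -/
theorem trace_eq_add_of_exact {A B C : Type*} [AddCommGroup A] [Module ℂ A] [Module.Finite ℂ A]
    [AddCommGroup B] [Module ℂ B] [Module.Finite ℂ B]
    [AddCommGroup C] [Module ℂ C] [Module.Finite ℂ C]
    (f : A →ₗ[ℂ] B) (g : B →ₗ[ℂ] C) (hf : Function.Injective f) (hfg : Function.Exact f g)
    (hg : Function.Surjective g) (a : A →ₗ[ℂ] A) (b : B →ₗ[ℂ] B) (c : C →ₗ[ℂ] C)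
    (hab : b ∘ₗ f = f ∘ₗ a) (hbc : g ∘ₗ b = c ∘ₗ g) :
    LinearMap.trace ℂ B b = LinearMap.trace ℂ A a + LinearMap.trace ℂ C c := by
  obtain ⟨g', hg'⟩ := g.exists_rightInverse_of_surjective (LinearMap.range_eq_top.2 hg)
  obtain ⟨f', hf'⟩ := f.exists_leftInverse_of_injective (LinearMap.ker_eq_bot.2 hf)
  -- correct the retraction so that it kills the image of the section
  set r : B →ₗ[ℂ] A := f' ∘ₗ (LinearMap.id - g' ∘ₗ g) with hr
  have hgg' : ∀ z, g (g' z) = z := fun z => LinearMap.congr_fun hg' z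
  have hff' : ∀ z, f' (f z) = z := fun z => LinearMap.congr_fun hf' z
  have hgf : ∀ z, g (f z) = 0 := fun z => (hfg (f z)).2 ⟨z, rfl⟩
  have hrf : r ∘ₗ f = LinearMap.id := by
    ext z
    simp [hr, hgf, hff']
  have hid : f ∘ₗ r + g' ∘ₗ g = LinearMap.id := by
    ext z
    obtain ⟨y, hy⟩ := (hfg (z - g' (g z))).1 (by simp [hgg'])
    have : r z = y := by
      simp only [hr, LinearMap.comp_apply, LinearMap.sub_apply, LinearMap.id_apply]
      rw [← hy, hff']
    simp [this, hy]
  calc LinearMap.trace ℂ B b = LinearMap.trace ℂ B (b ∘ₗ (f ∘ₗ r + g' ∘ₗ g)) := by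
        rw [hid, LinearMap.comp_id]
    _ = LinearMap.trace ℂ B ((b ∘ₗ f) ∘ₗ r) + LinearMap.trace ℂ B ((b ∘ₗ g') ∘ₗ g) := by
        rw [LinearMap.comp_add, map_add]; rfl
    _ = LinearMap.trace ℂ A (r ∘ₗ (b ∘ₗ f)) + LinearMap.trace ℂ C (g ∘ₗ (b ∘ₗ g')) := by
        rw [LinearMap.trace_comp_comm', LinearMap.trace_comp_comm' (f := b ∘ₗ g')]
    _ = LinearMap.trace ℂ A a + LinearMap.trace ℂ C c := by
        rw [hab, ← LinearMap.comp_assoc, hrf, LinearMap.id_comp, ← LinearMap.comp_assoc, hbc,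
          LinearMap.comp_assoc, hg', LinearMap.comp_id]

open Classical in
/-- There is a homomorphism on the Grothendieck group with `[𝒮_I^B] ↦ F_I^B` for all `I`. -/
theorem exists_chB (n : ℕ) : ∃ ch : GrothendieckB n →+ MvPowerSeries ℕ ℂ,
    ∀ I : Set (Fin n), ch (grothendieckClass n (SimpleMod n I)) = fundB n I := by
  let e : Set (Fin n) → HeckeB n := fun I =>
    ((List.finRange n).map fun j => if j ∈ I then -heckePi n j else 1 + heckePi n j).prod
  have he : ∀ I K : Set (Fin n), heckeChar n K (e I) = if I = K then 1 else 0 := by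
    intro I K
    simp only [e, map_list_prod, List.map_map]
    split_ifs with h
    · subst h
      apply List.prod_eq_one
      intro x hx
      obtain ⟨j, -, rfl⟩ := List.mem_map.1 hx
      by_cases hj : j ∈ I <;> simp [hj, heckeChar_pi]
    · obtain ⟨j, hj⟩ : ∃ j, ¬ (j ∈ I ↔ j ∈ K) := by
        by_contra hcon
        push Not at hcon
        exact h (Set.ext hcon)
      apply List.prod_eq_zero
      refine List.mem_map.2 ⟨j, List.mem_finRange j, ?_⟩
      by_cases hI : j ∈ I <;> by_cases hK : j ∈ K <;> simp_all [heckeChar_pi]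
  let φ : HeckeMod n → MvPowerSeries ℕ ℂ := fun M =>
    ∑ I : Set (Fin n), LinearMap.trace ℂ M.carrier (Algebra.lsmul ℂ ℂ M.carrier (e I)) • fundB n I
  let ψ : FreeAbelianGroup (HeckeMod n) →+ MvPowerSeries ℕ ℂ := FreeAbelianGroup.lift φ
  have hψ : AddSubgroup.closure (grothendieckRelations n) ≤ ψ.ker := by
    rw [AddSubgroup.closure_le]
    rintro r ⟨A, B, C, f, g, hf, hfg, hg, rfl⟩
    have key : φ B = φ A + φ C := by
      simp only [φ, ← Finset.sum_add_distrib, ← add_smul]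
      refine Finset.sum_congr rfl fun I _ => ?_
      rw [trace_eq_add_of_exact (f.restrictScalars ℂ) (g.restrictScalars ℂ) hf hfg hg
        (Algebra.lsmul ℂ ℂ A.carrier (e I)) (Algebra.lsmul ℂ ℂ B.carrier (e I))
        (Algebra.lsmul ℂ ℂ C.carrier (e I))]
      · ext z; simp
      · ext z; simp
    simp only [SetLike.mem_coe, AddMonoidHom.mem_ker, map_add, map_sub, ψ,
      FreeAbelianGroup.lift_apply_of, key]
    abel
  refine ⟨QuotientAddGroup.lift _ ψ hψ, fun K => ?_⟩
  have h1 : QuotientAddGroup.lift _ ψ hψ (grothendieckClass n (SimpleMod n K)) =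
      φ (HeckeMod.mk (SimpleMod n K)) := by
    simp [grothendieckClass, ψ]
  have h2 : ∀ I : Set (Fin n), LinearMap.trace ℂ (SimpleMod n K)
      (Algebra.lsmul ℂ ℂ (SimpleMod n K) (e I)) = if I = K then 1 else 0 := by
    intro I
    have : (Algebra.lsmul ℂ ℂ (SimpleMod n K) (e I) : SimpleMod n K →ₗ[ℂ] SimpleMod n K) =
        heckeChar n K (e I) • LinearMap.id := by
      ext
      rfl
    rw [this, map_smul, LinearMap.trace_id, he]
    have : Module.finrank ℂ (SimpleMod n K) = 1 := Module.finrank_self ℂ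
    simp [this]
  rw [h1]
  simp only [φ, h2]
  simp

/-- The type-B quasisymmetric characteristic: the homomorphism on the Grothendieck group with
`[𝒮_I^B] ↦ F_I^B` for all `I`. -/
noncomputable def chHom (n : ℕ) : GrothendieckB n →+ MvPowerSeries ℕ ℂ :=
  Classical.choose (exists_chB n)

theorem chHom_simple (n : ℕ) (I : Set (Fin n)) :
    chHom n (grothendieckClass n (SimpleMod n I)) = fundB n I :=
  Classical.choose_spec (exists_chB n) I

/-- The type-B quasisymmetric characteristic of a finite-dimensional `H_n^B(0)`-module. -/
noncomputable def chB (n : ℕ) (M : Type) [AddCommGroup M] [Module ℂ M] [Module (HeckeB n) M]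
    [IsScalarTower ℂ (HeckeB n) M] [Module.Finite ℂ M] : MvPowerSeries ℕ ℂ :=
  chHom n (grothendieckClass n M)

/-!
Encode the right inversions of `w` as a set `N w` of reflections, so that
`N (s i * w) = N w ∆ {w⁻¹ * s i * w}`. Then `x ≤ y` in the left weak order if and only if
`N x ⊆ N y`, and both the inverses of descent classes and the intervals of the left weak order have
the form `X = {w | N w ∩ C = D}`. For an ascent `i` of `w ∈ X`, membership of `s i * w` in `X` only
depends on whether the reflection `w⁻¹ * s i * w` lies in `C`; this is ascent-compatibility.

In the basis `(-1) ^ ℓ(w) • w` of `ℂX`, the operator `-π_i` is the Demazure action, which replaces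
`w` by the longer of `w` and `s i * w`, truncated to zero outside `X`. Since `N` only grows under
this action, an element that has left `X` never returns, so the relations of the Demazure action of
`B_n` are inherited by `ℂX`. On the one-line notation of `w⁻¹`, the Demazure action sorts two
adjacent entries or makes the first entry negative, and its braid relations are identities between
minima and maxima.

Finally, the filtration of `ℂX` by length has as graded pieces the sums of the simple modules at the
descent sets of the elements of `X` of a given length.
-/

/-! ### Inversion cocycles, length and left weak order -/

section InversionCocycle

variable {ι G : Type*} [Group G] (s : ι → G)

theorem wordProd_cons (i : ι) (ω : List ι) : wordProd s (i :: ω) = s i * wordProd s ω := by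
  simp [wordProd]

theorem wordProd_append (ω ω' : List ι) :
    wordProd s (ω ++ ω') = wordProd s ω * wordProd s ω' := by
  simp [wordProd]

variable [DecidableEq G]

/-- `N` behaves like the map sending an element of a Coxeter group to its set of right inversions,
encoded as reflections: left multiplication by `s i` toggles the single reflection
`w⁻¹ * s i * w`, and every `w ≠ 1` has a left descent. This is all that is needed of a Coxeter group
to describe its length, its descents and its left weak order. -/
structure IsInversionCocycle (N : G → Finset G) : Prop where
  map_one : N 1 = ∅
  map_simple_mul (i : ι) (w : G) : N (s i * w) = symmDiff (N w) {w⁻¹ * s i * w}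
  exists_mem_of_ne_one {w : G} (hw : w ≠ 1) : ∃ i, w⁻¹ * s i * w ∈ N w

namespace IsInversionCocycle

variable {s} {N : G → Finset G} (hN : IsInversionCocycle s N)
include hN

theorem eq_one_of_map_eq_empty {w : G} (hw : N w = ∅) : w = 1 := by
  by_contra hne
  obtain ⟨i, hi⟩ := hN.exists_mem_of_ne_one hne
  simp [hw] at hi

theorem simple_mul_self (i : ι) : s i * s i = 1 := by
  apply hN.eq_one_of_map_eq_empty
  have map_simple : N (s i) = {s i} := by
    simpa [hN.map_one, symmDiff_def] using hN.map_simple_mul i 1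
  rw [hN.map_simple_mul, map_simple, inv_mul_cancel, one_mul, symmDiff_self, Finset.bot_eq_empty]

theorem simple_mul_cancel (i : ι) (w : G) : s i * (s i * w) = w := by
  rw [← mul_assoc, hN.simple_mul_self, one_mul]

theorem map_simple_mul_of_notMem {i : ι} {w : G} (h : w⁻¹ * s i * w ∉ N w) :
    N (s i * w) = insert (w⁻¹ * s i * w) (N w) := by
  rw [hN.map_simple_mul, symmDiff_comm, (Finset.disjoint_singleton_left.2 h).symmDiff_eq_sup,
    Finset.sup_eq_union, Finset.singleton_union]

theorem map_simple_mul_of_mem {i : ι} {w : G} (h : w⁻¹ * s i * w ∈ N w) :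
    N (s i * w) = (N w).erase (w⁻¹ * s i * w) := by
  rw [hN.map_simple_mul, symmDiff_of_ge (Finset.singleton_subset_iff.2 h),
    Finset.sdiff_singleton_eq_erase]

theorem card_map_wordProd_le (ω : List ι) : (N (wordProd s ω)).card ≤ ω.length := by
  induction ω with
  | nil => simp [wordProd, hN.map_one]
  | cons i ω ih =>
    rw [wordProd_cons, hN.map_simple_mul, List.length_cons]
    refine (Finset.card_le_card symmDiff_le_sup).trans ((Finset.card_union_le _ _).trans ?_)
    simpa using ih

theorem exists_word_length_eq_card (w : G) :
    ∃ ω : List ι, wordProd s ω = w ∧ ω.length = (N w).card := by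
  induction hk : (N w).card generalizing w with
  | zero => exact ⟨[], (hN.eq_one_of_map_eq_empty (Finset.card_eq_zero.1 hk)).symm, rfl⟩
  | succ k ih =>
    obtain ⟨i, hi⟩ := hN.exists_mem_of_ne_one (w := w) fun h => by simp [h, hN.map_one] at hk
    obtain ⟨ω, hω, hlen⟩ := ih (s i * w) <| by
      rw [hN.map_simple_mul_of_mem hi, Finset.card_erase_of_mem hi, hk, Nat.add_sub_cancel]
    exact ⟨i :: ω, by rw [wordProd_cons, hω, hN.simple_mul_cancel], by simp [hlen]⟩

theorem isReducedWord_iff {ω : List ι} {w : G} :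
    IsReducedWord s ω w ↔ wordProd s ω = w ∧ ω.length = (N w).card := by
  refine and_congr_right fun hω => ⟨fun hmin => ?_, fun hlen ω' hω' => ?_⟩
  · obtain ⟨ω', hω', hlen'⟩ := hN.exists_word_length_eq_card w
    exact ((hmin ω' hω').trans_eq hlen').antisymm (hω ▸ hN.card_map_wordProd_le ω)
  · exact hlen.trans_le (hω' ▸ hN.card_map_wordProd_le ω')

theorem wordLength_eq (w : G) : wordLength s w = (N w).card := by
  obtain ⟨ω, hω, hlen⟩ := hN.exists_word_length_eq_card w
  refine le_antisymm (Nat.sInf_le ⟨ω, hω, hlen⟩) (le_csInf ⟨_, ω, hω, hlen⟩ ?_)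
  rintro k ⟨ω', rfl, rfl⟩
  exact hN.card_map_wordProd_le ω'

theorem mem_Des_iff {i : ι} {w : G} : i ∈ Des s w ↔ w⁻¹ * s i * w ∈ N w := by
  change wordLength s (s i * w) < wordLength s w ↔ _
  rw [hN.wordLength_eq, hN.wordLength_eq]
  refine ⟨fun hlt => by_contra fun h => ?_, fun h => ?_⟩
  · rw [hN.map_simple_mul_of_notMem h, Finset.card_insert_of_notMem h] at hlt
    omega
  · rw [hN.map_simple_mul_of_mem h]
    exact Finset.card_erase_lt_of_mem h

theorem wordLength_simple_mul {i : ι} {w : G} (hi : i ∉ Des s w) :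
    wordLength s (s i * w) = wordLength s w + 1 := by
  rw [hN.mem_Des_iff] at hi
  rw [hN.wordLength_eq, hN.wordLength_eq, hN.map_simple_mul_of_notMem hi,
    Finset.card_insert_of_notMem hi]

theorem map_mul (x y : G) :
    N (x * y) = symmDiff (N y) ((N x).image fun t => y⁻¹ * t * y) := by
  obtain ⟨ω, rfl, -⟩ := hN.exists_word_length_eq_card x
  have conj_injective : Function.Injective fun t => y⁻¹ * t * y := fun t t' h => by simpa using h
  induction ω with
  | nil => simp [wordProd, hN.map_one, symmDiff_def]
  | cons i ω ih =>
    rw [wordProd_cons, mul_assoc, hN.map_simple_mul, ih, hN.map_simple_mul,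
      Finset.image_symmDiff _ _ conj_injective, Finset.image_singleton, ← symmDiff_assoc]
    congr 2
    group

theorem simple_mem_map_iff {i : ι} {w : G} : s i ∈ N w ↔ i ∈ Des s w⁻¹ := by
  have hzero : N (w * w⁻¹) = ∅ := by rw [mul_inv_cancel, hN.map_one]
  rw [hN.map_mul, ← Finset.bot_eq_empty, symmDiff_eq_bot] at hzero
  rw [hN.mem_Des_iff, hzero, inv_inv, Finset.mem_image]
  refine ⟨fun h => ⟨s i, h, rfl⟩, ?_⟩
  rintro ⟨t, ht, h⟩
  rwa [← mul_left_cancel (mul_right_cancel h)]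

theorem card_map_mul_inv (x y : G) : (N (y * x⁻¹)).card = (N x \ N y).card + (N y \ N x).card := by
  have conj_injective : Function.Injective fun t => x⁻¹ * t * x := fun t t' h => by simpa using h
  have map_y := hN.map_mul (y * x⁻¹) x
  rw [inv_mul_cancel_right] at map_y
  rw [← Finset.card_image_of_injective (N (y * x⁻¹)) conj_injective,
    ← Finset.card_union_of_disjoint disjoint_sdiff_sdiff, ← Finset.sup_eq_union, ← symmDiff_def,
    map_y, symmDiff_symmDiff_cancel_left]

theorem leftWeakLE_iff {x y : G} : LeftWeakLE s x y ↔ N x ⊆ N y := by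
  have card_mul_inv := hN.card_map_mul_inv x y
  have card_x := Finset.card_sdiff_add_card_inter (N x) (N y)
  have card_y := Finset.card_sdiff_add_card_inter (N y) (N x)
  rw [Finset.inter_comm] at card_y
  rw [← Finset.sdiff_eq_empty_iff_subset, ← Finset.card_eq_zero]
  constructor
  · rintro ⟨ωx, _, hx, hy, ω, rfl⟩
    rw [hN.isReducedWord_iff] at hx hy
    rw [wordProd_append, hx.1, List.length_append, hx.2] at hy
    have hle := hN.card_map_wordProd_le ω
    rw [eq_mul_inv_of_mul_eq hy.1] at hle
    omega
  · intro hsub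
    obtain ⟨ωx, hωx, hx⟩ := hN.exists_word_length_eq_card x
    obtain ⟨ω, hω, hlen⟩ := hN.exists_word_length_eq_card (y * x⁻¹)
    refine ⟨ωx, ω ++ ωx, hN.isReducedWord_iff.2 ⟨hωx, hx⟩, hN.isReducedWord_iff.2 ⟨?_, ?_⟩,
      ω.suffix_append ωx⟩
    · rw [wordProd_append, hωx, hω, inv_mul_cancel_right]
    · rw [List.length_append]
      omega

end IsInversionCocycle

end InversionCocycle

/-! ### Classes of elements with prescribed inversions -/

section InvClass

variable {ι G : Type*} [Group G] [DecidableEq G] {s : ι → G} {N : G → Finset G}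

/-- The elements whose inversions in `C` are exactly those in `D`. Inverses of descent classes and
intervals of the left weak order are both of this kind. -/
def invClass (N : G → Finset G) (C D : Set G) : Set G := {w | (N w : Set G) ∩ C = D}

namespace IsInversionCocycle

variable (hN : IsInversionCocycle s N)
include hN

theorem simple_mul_mem_invClass_iff {C D : Set G} {w : G} (hw : w ∈ invClass N C D) {i : ι}
    (hi : i ∉ Des s w) : s i * w ∈ invClass N C D ↔ w⁻¹ * s i * w ∉ C := by
  rw [hN.mem_Des_iff] at hi
  change (N (s i * w) : Set G) ∩ C = D ↔ _
  rw [hN.map_simple_mul_of_notMem hi, Finset.coe_insert]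
  refine ⟨fun h hC => ?_, fun hC => by rwa [Set.insert_inter_of_notMem hC]⟩
  have hD : w⁻¹ * s i * w ∈ D := h ▸ ⟨Set.mem_insert _ _, hC⟩
  exact hi (hw.symm ▸ hD : _ ∈ (N w : Set G) ∩ C).1

theorem ascentCompatible_invClass (C D : Set G) : AscentCompatible s (invClass N C D) := by
  rintro u hu v hv i j ⟨hi, hj, huv⟩
  rw [hN.simple_mul_mem_invClass_iff hu hi, hN.simple_mul_mem_invClass_iff hv hj, huv]

theorem inv_descentClass_eq_invClass (hs : Function.Injective s) (I : Set ι) :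
    (descentClass s I)⁻¹ = invClass N (Set.range s) (s '' I) := by
  ext w
  have inter_range : (N w : Set G) ∩ Set.range s = s '' Des s w⁻¹ := by
    ext t
    constructor
    · rintro ⟨ht, i, rfl⟩
      exact ⟨i, hN.simple_mem_map_iff.1 ht, rfl⟩
    · rintro ⟨i, hi, rfl⟩
      exact ⟨hN.simple_mem_map_iff.2 hi, i, rfl⟩
  change Des s w⁻¹ = I ↔ (N w : Set G) ∩ Set.range s = s '' I
  rw [inter_range, hs.image_injective.eq_iff]

theorem leftInterval_eq_invClass {x y : G} (hxy : LeftWeakLE s x y) :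
    leftInterval s x y = invClass N (↑(N x) ∪ (↑(N y))ᶜ) (N x) := by
  rw [hN.leftWeakLE_iff] at hxy
  ext z
  change LeftWeakLE s x z ∧ LeftWeakLE s z y ↔ (N z : Set G) ∩ _ = _
  rw [hN.leftWeakLE_iff, hN.leftWeakLE_iff, Set.ext_iff]
  simp only [Set.mem_inter_iff, Set.mem_union, Set.mem_compl_iff, SetLike.mem_coe]
  simp only [Finset.subset_iff] at hxy ⊢
  grind

end IsInversionCocycle

end InvClass

/-! ### The operators `π_i` and the Demazure action -/

section Demazure

variable {ι G : Type*} [Group G]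

open Classical in
/-- The Demazure action of the generator `s i`: multiply by it on the left if this increases the
length. -/
noncomputable def demazure (s : ι → G) (i : ι) (w : G) : G := if i ∈ Des s w then w else s i * w

open Classical in
/-- The vector `(-1) ^ ℓ(y) • y` of `ℂX`, read as `0` if `y ∉ X`. The sign is chosen so that the
operators `-π_i` move these vectors according to the Demazure action. -/
noncomputable def signedVec (s : ι → G) (X : Set G) (y : G) : X →₀ ℂ :=
  if hy : y ∈ X then Finsupp.single ⟨y, hy⟩ ((-1) ^ wordLength s y) else 0

variable {s : ι → G}

theorem demazure_of_mem {i : ι} {w : G} (hi : i ∈ Des s w) : demazure s i w = w := if_pos hi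

theorem demazure_of_notMem {i : ι} {w : G} (hi : i ∉ Des s w) : demazure s i w = s i * w :=
  if_neg hi

theorem signedVec_of_mem {X : Set G} {y : G} (hy : y ∈ X) :
    signedVec s X y = (-1 : ℂ) ^ wordLength s y • Finsupp.single ⟨y, hy⟩ 1 := by
  rw [signedVec, dif_pos hy, Finsupp.smul_single_one]

theorem signedVec_of_notMem {X : Set G} {y : G} (hy : y ∉ X) : signedVec s X y = 0 := dif_neg hy

open Classical in
theorem piOp_single_one (X : Set G) (i : ι) (x : X) :
    piOp s X i (Finsupp.single x 1) =
      if i ∈ Des s (x : G) then -Finsupp.single x 1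
      else if h : s i * (x : G) ∈ X then Finsupp.single ⟨s i * (x : G), h⟩ 1 else 0 := by
  rw [piOp, Finsupp.linearCombination_single, one_smul]

namespace IsInversionCocycle

variable [DecidableEq G] {N : G → Finset G} (hN : IsInversionCocycle s N)
include hN

theorem subset_map_demazure (i : ι) (w : G) : N w ⊆ N (demazure s i w) := by
  by_cases hi : i ∈ Des s w
  · rw [demazure_of_mem hi]
  · rw [demazure_of_notMem hi, hN.map_simple_mul_of_notMem (mt hN.mem_Des_iff.2 hi)]
    exact Finset.subset_insert _ _

theorem neg_piOp_signedVec {C D : Set G} (i : ι) {y : G} (hy : D ⊆ ↑(N y) ∩ C) :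
    (-piOp s (invClass N C D) i) (signedVec s (invClass N C D) y) =
      signedVec s (invClass N C D) (demazure s i y) := by
  rw [LinearMap.neg_apply, neg_eq_iff_eq_neg]
  by_cases hyX : y ∈ invClass N C D
  · rw [signedVec_of_mem hyX, map_smul, piOp_single_one]
    by_cases hi : i ∈ Des s y
    · rw [if_pos hi, demazure_of_mem hi, signedVec_of_mem hyX, smul_neg]
    · rw [if_neg hi, demazure_of_notMem hi]
      split_ifs with hsy
      · rw [signedVec_of_mem hsy, hN.wordLength_simple_mul hi, pow_succ', neg_one_mul, neg_smul,
          neg_neg]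
      · rw [signedVec_of_notMem hsy, smul_zero, neg_zero]
  · have hdX : demazure s i y ∉ invClass N C D := fun h => hyX <| Set.Subset.antisymm
      (fun _ ht => h.subset ⟨hN.subset_map_demazure i y ht.1, ht.2⟩) hy
    rw [signedVec_of_notMem hyX, signedVec_of_notMem hdX, map_zero, neg_zero]

theorem subset_map_foldr_demazure (ω : List ι) (y : G) : N y ⊆ N (ω.foldr (demazure s) y) := by
  induction ω with
  | nil => rfl
  | cons i ω ih => exact ih.trans (hN.subset_map_demazure i _)

theorem prod_neg_piOp_signedVec {C D : Set G} (ω : List ι) {y : G} (hy : D ⊆ ↑(N y) ∩ C) :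
    (ω.map fun i => -piOp s (invClass N C D) i).prod (signedVec s (invClass N C D) y) =
      signedVec s (invClass N C D) (ω.foldr (demazure s) y) := by
  induction ω with
  | nil => rfl
  | cons i ω ih =>
    have hω : D ⊆ ↑(N (ω.foldr (demazure s) y)) ∩ C := hy.trans <|
      Set.inter_subset_inter_left _ (Finset.coe_subset.2 (hN.subset_map_foldr_demazure ω y))
    rw [List.map_cons, List.prod_cons, Module.End.mul_apply, ih, hN.neg_piOp_signedVec i hω,
      List.foldr_cons]

theorem prod_neg_piOp_eq_of_foldr_demazure_eq (C D : Set G) {ω ω' : List ι}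
    (h : ∀ w, ω.foldr (demazure s) w = ω'.foldr (demazure s) w) :
    (ω.map fun i => -piOp s (invClass N C D) i).prod =
      (ω'.map fun i => -piOp s (invClass N C D) i).prod := by
  refine Finsupp.lhom_ext' fun x => LinearMap.ext_ring ?_
  have hx : Finsupp.single x 1 =
      (-1 : ℂ) ^ wordLength s (x : G) • signedVec s (invClass N C D) x := by
    rw [signedVec_of_mem x.2, smul_smul, ← mul_pow, neg_one_mul, neg_neg, one_pow, one_smul]
  have hD : D ⊆ ↑(N (x : G)) ∩ C := x.2.superset
  rw [LinearMap.comp_apply, LinearMap.comp_apply, Finsupp.lsingle_apply, hx, map_smul,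
    map_smul, hN.prod_neg_piOp_signedVec ω hD, hN.prod_neg_piOp_signedVec ω' hD, h]

end IsInversionCocycle

end Demazure

/-! ### Reflections and inversions in the hyperoctahedral group -/

section Inversions

variable {n : ℕ}

theorem SignedSet.bounds (x : SignedSet n) : (x : ℤ) ≠ 0 ∧ -(n : ℤ) ≤ x ∧ (x : ℤ) ≤ n := by
  simpa only [Finset.mem_erase, Finset.mem_Icc] using x.2

theorem SignedSet.neg_lt_neg_iff {x y : SignedSet n} : -x < -y ↔ y < x := by
  simp only [← Subtype.coe_lt_coe, SignedSet.coe_neg, _root_.neg_lt_neg_iff]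

theorem coe_pos (j : Fin n) : ((pos j : SignedSet n) : ℤ) = j + 1 := rfl

theorem pos_lt_pos {j k : Fin n} : (pos j : SignedSet n) < pos k ↔ j < k := by
  rw [← Subtype.coe_lt_coe, coe_pos, coe_pos, Fin.lt_def]
  omega

theorem SignedSet.exists_eq_pos {x : SignedSet n} (hx : 0 < (x : ℤ)) : ∃ j, x = pos j := by
  have hn := x.bounds
  refine ⟨⟨((x : ℤ) - 1).toNat, by omega⟩, Subtype.ext ?_⟩
  rw [coe_pos]
  simp only
  omega

theorem SignedSet.exists_eq_pos_or_eq_neg_pos (x : SignedSet n) :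
    ∃ j, x = pos j ∨ x = -pos j := by
  rcases x.bounds.1.lt_or_gt with hx | hx
  · obtain ⟨j, hj⟩ := exists_eq_pos (x := -x) (by rw [coe_neg]; omega)
    exact ⟨j, .inr (neg_eq_iff_eq_neg.1 hj)⟩
  · exact (exists_eq_pos hx).imp fun _ => .inl

namespace BGroup

theorem apply_neg (w : BGroup n) (x : SignedSet n) : w.1 (-x) = -w.1 x := w.2 x

theorem mul_apply (u w : BGroup n) (x : SignedSet n) : (u * w).1 x = u.1 (w.1 x) := rfl

theorem inv_apply_self (w : BGroup n) (x : SignedSet n) : (w⁻¹).1 (w.1 x) = x :=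
  Equiv.symm_apply_apply w.1 x

theorem apply_inv_self (w : BGroup n) (x : SignedSet n) : w.1 ((w⁻¹).1 x) = x :=
  Equiv.apply_symm_apply w.1 x

theorem ext_apply {u w : BGroup n} (h : ∀ x, u.1 x = w.1 x) : u = w := Subtype.ext (Equiv.ext h)

theorem ext_pos {u w : BGroup n} (h : ∀ j, u.1 (pos j) = w.1 (pos j)) : u = w := by
  refine ext_apply fun x => ?_
  obtain ⟨j, rfl | rfl⟩ := x.exists_eq_pos_or_eq_neg_pos
  · exact h j
  · rw [apply_neg, apply_neg, h]

end BGroup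

theorem coe_simpleB_apply (i : Fin n) (x : SignedSet n) :
    (((simpleB n i).1 x : SignedSet n) : ℤ) =
      if (i : ℕ) = 0 then (if (x : ℤ) = 1 ∨ (x : ℤ) = -1 then -(x : ℤ) else x)
      else if (x : ℤ) = i then (x : ℤ) + 1
      else if (x : ℤ) = i + 1 then (x : ℤ) - 1
      else if (x : ℤ) = -i then (x : ℤ) - 1
      else if (x : ℤ) = -(i + 1) then (x : ℤ) + 1
      else x := by
  by_cases h : (i : ℕ) = 0
  · simp only [simpleB, h, dif_pos, if_true, Equiv.swap_apply_def, Subtype.ext_iff,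
      SignedSet.coe_neg, coe_pos]
    split_ifs <;> (try simp only [SignedSet.coe_neg, coe_pos]) <;> omega
  · simp only [simpleB, h, if_false, Equiv.Perm.mul_apply, Equiv.swap_apply_def,
      Subtype.ext_iff, dif_neg, not_false_eq_true, SignedSet.coe_neg, coe_pos]
    split_ifs <;> (try simp only [SignedSet.coe_neg, coe_pos] at *) <;> omega

theorem simpleB_simpleB_apply (i : Fin n) (x : SignedSet n) :
    (simpleB n i).1 ((simpleB n i).1 x) = x := by
  have hy := coe_simpleB_apply i x
  rw [Subtype.ext_iff, coe_simpleB_apply]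
  split_ifs at hy ⊢ <;> omega

theorem simpleB_inv (i : Fin n) : (simpleB n i)⁻¹ = simpleB n i :=
  inv_eq_of_mul_eq_one_left (BGroup.ext_apply (simpleB_simpleB_apply i))

theorem simpleB_apply_pos_lt (i : Fin n) : (simpleB n i).1 (pos i) < pos i := by
  rw [← Subtype.coe_lt_coe, coe_simpleB_apply, coe_pos]
  split_ifs <;> omega

theorem simpleB_apply_pos_of_ne {i j : Fin n} (h : (j : ℕ) ≠ i) (h' : (j : ℕ) + 1 ≠ i) :
    (simpleB n i).1 (pos j) = pos j := by
  rw [Subtype.ext_iff, coe_simpleB_apply, coe_pos]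
  split_ifs <;> omega

theorem simpleB_apply_pos_zero : (simpleB (n + 1) 0).1 (pos 0) = -pos 0 := by
  rw [Subtype.ext_iff, coe_simpleB_apply, SignedSet.coe_neg, coe_pos]
  simp

theorem simpleB_apply_pos_succ (j : Fin n) :
    (simpleB (n + 1) j.succ).1 (pos j.succ) = pos j.castSucc := by
  rw [Subtype.ext_iff, coe_simpleB_apply, coe_pos, coe_pos, Fin.val_succ, Fin.val_castSucc,
    if_neg (Nat.succ_ne_zero _), Nat.cast_succ, if_neg (by omega), if_pos rfl, add_sub_cancel_right]

theorem simpleB_injective : Function.Injective (simpleB n) := by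
  refine Function.Injective.of_lt_imp_ne fun i j hij h => (simpleB_apply_pos_lt j).ne ?_
  rw [← h, simpleB_apply_pos_of_ne (by omega) (by omega)]

theorem simpleB_lt_iff (i : Fin n) {x y : SignedSet n} (h : (simpleB n i).1 x ≠ y) :
    (simpleB n i).1 x < (simpleB n i).1 y ↔ x < y := by
  have hx := x.bounds
  have hy := y.bounds
  rw [Ne, Subtype.ext_iff, coe_simpleB_apply] at h
  rw [← Subtype.coe_lt_coe, ← Subtype.coe_lt_coe, coe_simpleB_apply, coe_simpleB_apply]
  split_ifs at h ⊢ <;> omega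

theorem simpleB_apply_ne_self {i : Fin n} {x y : SignedSet n} (hx : (simpleB n i).1 x ≠ x)
    (hy : (simpleB n i).1 y ≠ y) :
    y = x ∨ y = (simpleB n i).1 x ∨ y = -x ∨ y = -(simpleB n i).1 x := by
  simp only [Ne, Subtype.ext_iff, SignedSet.coe_neg, coe_simpleB_apply] at hx hy ⊢
  split_ifs at hx hy ⊢ <;> omega

namespace BGroup

/-- The reflections of `B_n`: the conjugates of the generators. -/
def IsReflection (t : BGroup n) : Prop := ∃ u i, t = u⁻¹ * simpleB n i * u

theorem isReflection_conj (u : BGroup n) (i : Fin n) : IsReflection (u⁻¹ * simpleB n i * u) :=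
  ⟨u, i, rfl⟩

namespace IsReflection

variable {t : BGroup n}

theorem apply_apply (ht : IsReflection t) (x : SignedSet n) : t.1 (t.1 x) = x := by
  obtain ⟨u, i, rfl⟩ := ht
  simp only [mul_apply, apply_inv_self, simpleB_simpleB_apply, inv_apply_self]

theorem apply_ne_self (ht : IsReflection t) {x y : SignedSet n} (hx : t.1 x ≠ x)
    (hy : t.1 y ≠ y) : y = x ∨ y = t.1 x ∨ y = -x ∨ y = -t.1 x := by
  obtain ⟨u, i, rfl⟩ := ht
  have moved {z : SignedSet n} (hz : (u⁻¹ * simpleB n i * u).1 z ≠ z) :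
      (simpleB n i).1 (u.1 z) ≠ u.1 z := fun h => hz <| by
    rw [mul_apply, mul_apply, h, inv_apply_self]
  have h := simpleB_apply_ne_self (moved hx) (moved hy)
  rw [← apply_inv_self u ((simpleB n i).1 (u.1 x)), ← apply_neg, ← apply_neg] at h
  simpa only [u.1.injective.eq_iff, mul_apply] using h

theorem exists_lt_apply (ht : IsReflection t) : ∃ a, a < t.1 a := by
  obtain ⟨u, i, rfl⟩ := ht
  have hne : (u⁻¹).1 ((simpleB n i).1 (pos i)) ≠ (u⁻¹).1 (pos i) :=
    (u⁻¹).1.injective.ne (simpleB_apply_pos_lt i).ne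
  rcases hne.lt_or_gt with hlt | hlt
  · refine ⟨(u⁻¹).1 ((simpleB n i).1 (pos i)), ?_⟩
    rwa [mul_apply, mul_apply, apply_inv_self, simpleB_simpleB_apply]
  · refine ⟨(u⁻¹).1 (pos i), ?_⟩
    rwa [mul_apply, mul_apply, apply_inv_self]

theorem eq_of_apply_eq {t' : BGroup n} (ht : IsReflection t) (ht' : IsReflection t')
    {a : SignedSet n} (ha : t.1 a ≠ a) (h : t.1 a = t'.1 a) : t = t' := by
  have agree {x : SignedSet n} (hx : x = a ∨ x = t.1 a ∨ x = -a ∨ x = -t.1 a) :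
      t.1 x = t'.1 x := by
    have h' : t.1 (t.1 a) = t'.1 (t.1 a) := by rw [ht.apply_apply, h, ht'.apply_apply]
    rcases hx with rfl | rfl | rfl | rfl
    · exact h
    · exact h'
    · rw [apply_neg, apply_neg, h]
    · rw [apply_neg, apply_neg, h']
  refine ext_apply fun x => ?_
  by_cases hx : t.1 x = x
  · by_cases hx' : t'.1 x = x
    · rw [hx, hx']
    · exact agree (h ▸ ht'.apply_ne_self (h ▸ ha) hx')
  · exact agree (ht.apply_ne_self ha hx)

theorem eq_or_eq_neg_of_lt_apply (ht : IsReflection t) {a b : SignedSet n} (ha : a < t.1 a)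
    (hb : b < t.1 b) : b = a ∨ b = -t.1 a := by
  rcases ht.apply_ne_self ha.ne' hb.ne' with rfl | rfl | rfl | rfl
  · exact .inl rfl
  · rw [ht.apply_apply] at hb
    exact absurd hb ha.not_gt
  · rw [apply_neg, SignedSet.neg_lt_neg_iff] at hb
    exact absurd hb ha.not_gt
  · exact .inr rfl

end IsReflection

/-- The (right) inversions of `w`, encoded as the reflections `t` that interchange the members of
a pair `a < t a` whose order `w` reverses. -/
noncomputable def inversions (w : BGroup n) : Finset (BGroup n) :=
  (Set.toFinite {t : BGroup n | IsReflection t ∧ ∃ a, a < t.1 a ∧ w.1 (t.1 a) < w.1 a}).toFinset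

theorem mem_inversions {w t : BGroup n} :
    t ∈ inversions w ↔ IsReflection t ∧ ∃ a, a < t.1 a ∧ w.1 (t.1 a) < w.1 a :=
  Set.Finite.mem_toFinset _

theorem IsReflection.mem_inversions_iff {t : BGroup n} (ht : IsReflection t) {a : SignedSet n}
    (ha : a < t.1 a) (w : BGroup n) : t ∈ inversions w ↔ w.1 (t.1 a) < w.1 a := by
  rw [mem_inversions]
  refine ⟨?_, fun h => ⟨ht, a, ha, h⟩⟩
  rintro ⟨-, b, hb, hwb⟩
  obtain rfl | rfl := ht.eq_or_eq_neg_of_lt_apply ha hb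
  · exact hwb
  · rwa [apply_neg, ht.apply_apply, apply_neg, apply_neg, SignedSet.neg_lt_neg_iff] at hwb

theorem conj_mem_inversions_iff {w : BGroup n} {i : Fin n} :
    w⁻¹ * simpleB n i * w ∈ inversions w ↔
      (w⁻¹).1 (pos i) < (w⁻¹).1 ((simpleB n i).1 (pos i)) := by
  have ht := isReflection_conj w i
  have hlow : (w⁻¹ * simpleB n i * w).1 ((w⁻¹).1 (pos i)) =
      (w⁻¹).1 ((simpleB n i).1 (pos i)) := by
    rw [mul_apply, mul_apply, apply_inv_self]
  have hne : (w⁻¹).1 (pos i) ≠ (w⁻¹).1 ((simpleB n i).1 (pos i)) :=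
    (w⁻¹).1.injective.ne (simpleB_apply_pos_lt i).ne'
  rcases hne.lt_or_gt with hlt | hlt
  · simp only [ht.mem_inversions_iff (a := (w⁻¹).1 (pos i)) (by rwa [hlow]), hlow,
      apply_inv_self, simpleB_apply_pos_lt, hlt]
  · have hhigh := ht.apply_apply ((w⁻¹).1 (pos i))
    rw [hlow] at hhigh
    simp only [ht.mem_inversions_iff (a := (w⁻¹).1 ((simpleB n i).1 (pos i))) (by rwa [hhigh]),
      hhigh, apply_inv_self, (simpleB_apply_pos_lt i).not_gt, hlt.not_gt]

theorem eq_one_of_strictMono {w : BGroup n} (hw : StrictMono w.1) : w = 1 := by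
  have h : hw.orderIsoOfSurjective _ w.1.surjective = OrderIso.refl _ := Subsingleton.elim _ _
  exact ext_apply fun x => DFunLike.congr_fun h x

theorem strictMono_of_simpleB_lt {w : BGroup n}
    (hw : ∀ i, w.1 ((simpleB n i).1 (pos i)) < w.1 (pos i)) : StrictMono w.1 := by
  obtain _ | m := n
  · exact fun x => (x.exists_eq_pos_or_eq_neg_pos.choose).elim0
  have strictMono_pos : StrictMono fun j : Fin (m + 1) => w.1 (pos j) :=
    Fin.strictMono_iff_lt_succ.2 fun j => by simpa only [simpleB_apply_pos_succ] using hw j.succ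
  have apply_pos (j : Fin (m + 1)) : 0 < (w.1 (pos j) : ℤ) := by
    have h0 := hw 0
    rw [simpleB_apply_pos_zero, apply_neg, ← Subtype.coe_lt_coe, SignedSet.coe_neg] at h0
    have hle : (w.1 (pos 0) : ℤ) ≤ w.1 (pos j) := strictMono_pos.monotone (Fin.zero_le j)
    omega
  intro x y hxy
  obtain ⟨j, rfl | rfl⟩ := x.exists_eq_pos_or_eq_neg_pos <;>
  obtain ⟨k, rfl | rfl⟩ := y.exists_eq_pos_or_eq_neg_pos
  · exact strictMono_pos (pos_lt_pos.1 hxy)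
  · rw [← Subtype.coe_lt_coe, SignedSet.coe_neg, coe_pos, coe_pos] at hxy
    omega
  · rw [apply_neg, ← Subtype.coe_lt_coe, SignedSet.coe_neg]
    exact (neg_neg_of_pos (apply_pos j)).trans (apply_pos k)
  · rw [apply_neg, apply_neg, SignedSet.neg_lt_neg_iff]
    exact strictMono_pos (pos_lt_pos.1 (SignedSet.neg_lt_neg_iff.1 hxy))

open Classical in
theorem inversions_simpleB_mul (i : Fin n) (w : BGroup n) :
    inversions (simpleB n i * w) = symmDiff (inversions w) {w⁻¹ * simpleB n i * w} := by
  ext t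
  rw [Finset.mem_symmDiff, Finset.mem_singleton]
  by_cases ht : IsReflection t
  · obtain ⟨a, ha⟩ := ht.exists_lt_apply
    rw [ht.mem_inversions_iff ha, ht.mem_inversions_iff ha, mul_apply, mul_apply]
    by_cases heq : t = w⁻¹ * simpleB n i * w
    · have swaps : (simpleB n i).1 (w.1 a) = w.1 (t.1 a) := by
        rw [heq, mul_apply, mul_apply, apply_inv_self]
      have hne : w.1 a ≠ w.1 (t.1 a) := w.1.injective.ne ha.ne
      rw [← swaps, simpleB_simpleB_apply, swaps]
      simp only [iff_true_intro heq, not_true, and_false, true_and, false_or, not_lt,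
        hne.le_iff_lt]
    · have not_swaps : (simpleB n i).1 (w.1 (t.1 a)) ≠ w.1 a := fun h => heq <| by
        refine ht.eq_of_apply_eq (isReflection_conj w i) ha.ne' ?_
        rw [mul_apply, mul_apply, ← h, simpleB_simpleB_apply, inv_apply_self]
      simp only [simpleB_lt_iff i not_swaps, heq, not_false_eq_true, and_true, false_and, or_false]
  · have hne : t ≠ w⁻¹ * simpleB n i * w := fun h => ht (h ▸ isReflection_conj w i)
    simp only [mem_inversions, ht, hne, false_and, or_self]

open Classical in
theorem isInversionCocycle_inversions : IsInversionCocycle (simpleB n) inversions where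
  map_one := Finset.eq_empty_of_forall_notMem fun t ht => by
    obtain ⟨-, a, ha, ha'⟩ := mem_inversions.1 ht
    exact lt_asymm ha ha'
  map_simple_mul := inversions_simpleB_mul
  exists_mem_of_ne_one {w} hw := by
    by_contra! hnone
    refine hw (inv_eq_one.1 (eq_one_of_strictMono (strictMono_of_simpleB_lt fun i => ?_)))
    have hle := not_lt.1 (mt conj_mem_inversions_iff.2 (hnone i))
    exact hle.lt_of_ne ((w⁻¹).1.injective.ne (simpleB_apply_pos_lt i).ne)

theorem mem_Des_iff {i : Fin n} {w : BGroup n} :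
    i ∈ Des (simpleB n) w ↔ (w⁻¹).1 (pos i) < (w⁻¹).1 ((simpleB n i).1 (pos i)) := by
  classical
  rw [isInversionCocycle_inversions.mem_Des_iff, conj_mem_inversions_iff]

theorem exists_isReflection_apply_eq {x : BGroup n} {a b : SignedSet n} (hab : a < b)
    (hx : x.1 b < x.1 a) : ∃ t, IsReflection t ∧ t.1 a = b := by
  classical
  obtain ⟨ω, rfl, -⟩ := isInversionCocycle_inversions.exists_word_length_eq_card x
  induction ω with
  | nil => exact absurd hx hab.not_gt
  | cons i ω ih =>
    set y := wordProd (simpleB n) ω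
    rw [wordProd_cons, mul_apply, mul_apply] at hx
    by_cases hy : y.1 b < y.1 a
    · exact ih hy
    · have swaps : (simpleB n i).1 (y.1 b) = y.1 a :=
        by_contra fun h => hy ((simpleB_lt_iff i h).1 hx)
      refine ⟨y⁻¹ * simpleB n i * y, isReflection_conj y i, ?_⟩
      rw [mul_apply, mul_apply, ← swaps, simpleB_simpleB_apply, inv_apply_self]

theorem leftWeakLE_iff {x y : BGroup n} :
    LeftWeakLE (simpleB n) x y ↔
      ∀ a b : SignedSet n, -b ≤ a → a < b → x.1 b < x.1 a → y.1 b < y.1 a := by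
  classical
  rw [isInversionCocycle_inversions.leftWeakLE_iff]
  constructor
  · intro hsub a b _ hab hx
    obtain ⟨t, ht, rfl⟩ := exists_isReflection_apply_eq hab hx
    exact (ht.mem_inversions_iff hab y).1 (hsub ((ht.mem_inversions_iff hab x).2 hx))
  · intro h t hxt
    obtain ⟨ht, a, ha, hxa⟩ := mem_inversions.1 hxt
    rw [ht.mem_inversions_iff ha]
    rcases le_total (-t.1 a) a with hle | hle
    · exact h a _ hle ha hxa
    · have := h (-t.1 a) (-a) (by rwa [neg_neg]) (SignedSet.neg_lt_neg_iff.2 ha)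
      simpa only [apply_neg, SignedSet.neg_lt_neg_iff, hxa, true_imp_iff] using this

end BGroup

end Inversions

/-! ### The unimodal classes as intervals -/

section Unimodal

variable {n : ℕ}

/-- The element of `B_n` given by an odd involution of the integers that preserves `±[n]`. -/
def BGroup.ofInvolution (f : ℤ → ℤ)
    (hf : ∀ x ∈ (Finset.Icc (-(n : ℤ)) n).erase 0, f x ∈ (Finset.Icc (-(n : ℤ)) n).erase 0)
    (hff : ∀ x ∈ (Finset.Icc (-(n : ℤ)) n).erase 0, f (f x) = x)
    (hneg : ∀ x ∈ (Finset.Icc (-(n : ℤ)) n).erase 0, f (-x) = -f x) : BGroup n :=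
  ⟨Function.Involutive.toPerm (fun x : SignedSet n => ⟨f x, hf x x.2⟩)
    fun x => Subtype.ext (hff x x.2), fun x => Subtype.ext (hneg x x.2)⟩

/-- The least element of the inverse of the class `L_{i + 1}^B`: reversal of `1, …, i + 1`. -/
def unimodalMin (i : Fin n) : BGroup n :=
  BGroup.ofInvolution
    (fun x => if 0 < x ∧ x ≤ i + 1 then i + 2 - x
      else if x < 0 ∧ -((i : ℤ) + 1) ≤ x then -(i + 2) - x else x)
    (fun x hx => by
      simp only [Finset.mem_erase, Finset.mem_Icc] at hx ⊢
      split_ifs <;> omega)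
    (fun x hx => by
      simp only [Finset.mem_erase, Finset.mem_Icc] at hx
      split_ifs <;> omega)
    (fun x hx => by
      simp only [Finset.mem_erase, Finset.mem_Icc] at hx
      split_ifs <;> omega)

/-- The greatest element of the inverse of the class `L_{i + 1}^B`: negation of `1, …, i`, and
negation and reversal of `i + 1, …, n`. -/
def unimodalMax (i : Fin n) : BGroup n :=
  BGroup.ofInvolution
    (fun x => if (i : ℤ) < x then x - (i + 1) - n
      else if x < -(i : ℤ) then x + (i + 1) + n else -x)
    (fun x hx => by
      simp only [Finset.mem_erase, Finset.mem_Icc] at hx ⊢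
      split_ifs <;> omega)
    (fun x hx => by
      simp only [Finset.mem_erase, Finset.mem_Icc] at hx
      split_ifs <;> omega)
    (fun x hx => by
      simp only [Finset.mem_erase, Finset.mem_Icc] at hx
      split_ifs <;> omega)

theorem coe_unimodalMin_apply (i : Fin n) (x : SignedSet n) :
    ((unimodalMin i).1 x : ℤ) = if 0 < (x : ℤ) ∧ (x : ℤ) ≤ i + 1 then (i : ℤ) + 2 - x
      else if (x : ℤ) < 0 ∧ -((i : ℤ) + 1) ≤ x then -((i : ℤ) + 2) - x else x := rfl

theorem coe_unimodalMax_apply (i : Fin n) (x : SignedSet n) :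
    ((unimodalMax i).1 x : ℤ) = if (i : ℤ) < x then (x : ℤ) - (i + 1) - n
      else if (x : ℤ) < -(i : ℤ) then (x : ℤ) + (i + 1) + n else -x := rfl

theorem coe_unimodalMin_apply_pos (i j : Fin n) :
    ((unimodalMin i).1 (pos j) : ℤ) =
      if j ≤ i then ((i : ℤ) + 1) + 1 - ((j : ℤ) + 1) else (j : ℤ) + 1 := by
  simp only [coe_unimodalMin_apply, coe_pos, Fin.le_def]
  split_ifs <;> omega

theorem coe_unimodalMax_apply_pos (i j : Fin n) :
    ((unimodalMax i).1 (pos j) : ℤ) =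
      if j < i then -((j : ℤ) + 1) else ((j : ℤ) + 1) - ((i : ℤ) + 1) - (n : ℤ) := by
  simp only [coe_unimodalMax_apply, coe_pos, Fin.lt_def]
  split_ifs <;> omega

theorem unimodalMin_lt_iff (i : Fin n) {a b : SignedSet n} (hba : -b ≤ a) (hab : a < b) :
    (unimodalMin i).1 b < (unimodalMin i).1 a ↔ 0 < (a : ℤ) ∧ (b : ℤ) ≤ i + 1 := by
  have ha := a.bounds
  have hb := b.bounds
  rw [← Subtype.coe_le_coe, SignedSet.coe_neg] at hba
  rw [← Subtype.coe_lt_coe] at hab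
  rw [← Subtype.coe_lt_coe, coe_unimodalMin_apply, coe_unimodalMin_apply]
  split_ifs <;> omega

theorem unimodalMax_lt_iff (i : Fin n) {a b : SignedSet n} (hba : -b ≤ a) (hab : a < b) :
    (unimodalMax i).1 b < (unimodalMax i).1 a ↔ (a : ℤ) ≤ i := by
  have ha := a.bounds
  have hb := b.bounds
  rw [← Subtype.coe_le_coe, SignedSet.coe_neg] at hba
  rw [← Subtype.coe_lt_coe] at hab
  rw [← Subtype.coe_lt_coe, coe_unimodalMax_apply, coe_unimodalMax_apply]
  split_ifs <;> omega

theorem unimodalMin_le_unimodalMax (i : Fin n) :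
    LeftWeakLE (simpleB n) (unimodalMin i) (unimodalMax i) := by
  rw [BGroup.leftWeakLE_iff]
  intro a b hba hab hmin
  have hab' : (a : ℤ) < b := hab
  rw [unimodalMin_lt_iff i hba hab] at hmin
  rw [unimodalMax_lt_iff i hba hab]
  omega

theorem pos_le_iff {i j : Fin n} : ((pos j : SignedSet n) : ℤ) ≤ i + 1 ↔ j ≤ i := by
  rw [coe_pos, Fin.le_def]
  omega

theorem neg_pos_le_pos (j k : Fin n) : -pos k ≤ (pos j : SignedSet n) := by
  rw [← Subtype.coe_le_coe, SignedSet.coe_neg, coe_pos, coe_pos]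
  omega

theorem unimodalMin_le_iff {i : Fin n} {w : BGroup n} :
    LeftWeakLE (simpleB n) (unimodalMin i) w ↔
      StrictAntiOn (fun j : Fin n => (w.1 (pos j) : ℤ)) (Set.Iic i) := by
  rw [BGroup.leftWeakLE_iff]
  constructor
  · intro h j _ k hk hjk
    have hab := pos_lt_pos.2 hjk
    have hba := neg_pos_le_pos j k
    refine h _ _ hba hab ((unimodalMin_lt_iff i hba hab).2 ⟨?_, pos_le_iff.2 hk⟩)
    rw [coe_pos]
    omega
  · intro h a b hba hab hmin
    have hab' : (a : ℤ) < b := hab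
    obtain ⟨ha, hb⟩ := (unimodalMin_lt_iff i hba hab).1 hmin
    obtain ⟨j, rfl⟩ := SignedSet.exists_eq_pos ha
    obtain ⟨k, rfl⟩ := SignedSet.exists_eq_pos (ha.trans hab')
    exact h (pos_le_iff.1 (hab'.le.trans hb)) (pos_le_iff.1 hb) (pos_lt_pos.1 hab)

theorem le_unimodalMax_iff {i : Fin n} {w : BGroup n} :
    LeftWeakLE (simpleB n) w (unimodalMax i) ↔
      StrictMonoOn (fun j : Fin n => (w.1 (pos j) : ℤ)) (Set.Ici i) := by
  rw [BGroup.leftWeakLE_iff]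
  constructor
  · intro h j hj k _ hjk
    have hab := pos_lt_pos.2 hjk
    have hba := neg_pos_le_pos j k
    have hle : w.1 (pos j) ≤ w.1 (pos k) := not_lt.1 fun hlt => by
      have hmax := (unimodalMax_lt_iff i hba hab).1 (h _ _ hba hab hlt)
      have hij : (i : ℕ) ≤ j := hj
      rw [coe_pos] at hmax
      omega
    exact hle.lt_of_ne (w.1.injective.ne hab.ne)
  · intro h a b hba hab hw
    rw [unimodalMax_lt_iff i hba hab]
    by_contra! hia
    have hab' : (a : ℤ) < b := hab
    obtain ⟨j, rfl⟩ := SignedSet.exists_eq_pos (x := a) (by omega)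
    obtain ⟨k, rfl⟩ := SignedSet.exists_eq_pos (x := b) (by omega)
    rw [coe_pos] at hia
    have hij : i ≤ j := Fin.le_def.2 (by omega)
    have hjk := pos_lt_pos.1 hab
    exact hw.not_gt (h hij (hij.trans hjk.le) hjk)

theorem inv_leftUnimodalClass_eq (i : Fin n) :
    (leftUnimodalClass n i)⁻¹ = leftInterval (simpleB n) (unimodalMin i) (unimodalMax i) := by
  ext w
  change (StrictAntiOn (fun j => ((w⁻¹⁻¹ : BGroup n).1 (pos j) : ℤ)) _ ∧
    StrictMonoOn (fun j => ((w⁻¹⁻¹ : BGroup n).1 (pos j) : ℤ)) _) ↔ _ ∧ _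
  rw [inv_inv, unimodalMin_le_iff, le_unimodalMax_iff]

end Unimodal

/-! ### Braid relations of the Demazure action -/

section Sorting

/-- `sortAt (i + 1)` puts the entries at `i` and `i + 1` into decreasing order, and `sortAt 0` makes
the entry at `0` nonpositive. On one-line notations, this is the Demazure action. -/
def sortAt : ℕ → (ℕ → ℤ) → ℕ → ℤ
  | 0, v => fun k => if k = 0 then min (v 0) (-v 0) else v k
  | i + 1, v => fun k =>
      if k = i then max (v i) (v (i + 1)) else if k = i + 1 then min (v i) (v (i + 1)) else v k

theorem sortAt_sortAt (i : ℕ) (v : ℕ → ℤ) : sortAt i (sortAt i v) = sortAt i v := by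
  funext k
  cases i <;> simp only [sortAt, if_true] <;> split_ifs <;> omega

theorem sortAt_comm {i j : ℕ} (hij : i + 2 ≤ j) (v : ℕ → ℤ) :
    sortAt i (sortAt j v) = sortAt j (sortAt i v) := by
  obtain ⟨j, rfl⟩ := Nat.exists_eq_add_of_le' (one_le_two.trans (le_of_add_le_right hij))
  funext k
  cases i <;> simp only [sortAt] <;> split_ifs <;> first | contradiction | omega

theorem sortAt_braid (i : ℕ) (v : ℕ → ℤ) :
    sortAt (i + 1) (sortAt (i + 2) (sortAt (i + 1) v)) =
      sortAt (i + 2) (sortAt (i + 1) (sortAt (i + 2) v)) := by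
  funext k
  simp only [sortAt, if_true, Nat.succ_ne_self, (Nat.succ_ne_self _).symm, if_false,
    show i + 1 + 1 ≠ i by omega, show i ≠ i + 1 + 1 by omega]
  split_ifs <;> omega

theorem sortAt_braid_zero (v : ℕ → ℤ) :
    sortAt 0 (sortAt 1 (sortAt 0 (sortAt 1 v))) = sortAt 1 (sortAt 0 (sortAt 1 (sortAt 0 v))) := by
  funext k
  simp only [sortAt, if_true, if_false, one_ne_zero, zero_add, zero_ne_one]
  generalize v 0 = a, v 1 = b
  split_ifs <;> omega

variable {n : ℕ}

/-- The one-line notation of `w⁻¹`, with positions shifted by one and extended by zero. -/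
def invOneLine (w : BGroup n) : ℕ → ℤ := fun j =>
  if h : j < n then ((w⁻¹).1 (pos ⟨j, h⟩) : ℤ) else 0

theorem invOneLine_apply (w : BGroup n) (j : Fin n) : invOneLine w j = (w⁻¹).1 (pos j) :=
  dif_pos j.2

theorem invOneLine_injective : Function.Injective (invOneLine (n := n)) := by
  refine fun u w h => inv_injective (BGroup.ext_pos fun j => Subtype.ext ?_)
  rw [← invOneLine_apply, ← invOneLine_apply, h]

theorem BGroup.inv_simpleB_mul_apply (i : Fin n) (w : BGroup n) (x : SignedSet n) :
    ((simpleB n i * w)⁻¹).1 x = (w⁻¹).1 ((simpleB n i).1 x) := by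
  rw [mul_inv_rev, simpleB_inv, mul_apply]

theorem invOneLine_simpleB_mul_of_ne {i : Fin n} (w : BGroup n) {k : ℕ} (h : k ≠ i)
    (h' : k + 1 ≠ i) : invOneLine (simpleB n i * w) k = invOneLine w k := by
  simp only [invOneLine]
  split_ifs with hk
  · rw [BGroup.inv_simpleB_mul_apply, simpleB_apply_pos_of_ne h h']
  · rfl

theorem invOneLine_simpleB_zero_mul (w : BGroup (n + 1)) :
    invOneLine (simpleB (n + 1) 0 * w) 0 = -invOneLine w 0 := by
  have h := invOneLine_apply (simpleB (n + 1) 0 * w) 0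
  rwa [BGroup.inv_simpleB_mul_apply, simpleB_apply_pos_zero, BGroup.apply_neg, SignedSet.coe_neg,
    ← invOneLine_apply] at h

theorem invOneLine_simpleB_succ_mul_castSucc (j : Fin n) (w : BGroup (n + 1)) :
    invOneLine (simpleB (n + 1) j.succ * w) j = invOneLine w (j + 1) := by
  have h := invOneLine_apply (simpleB (n + 1) j.succ * w) j.castSucc
  rwa [BGroup.inv_simpleB_mul_apply, ← simpleB_apply_pos_succ, simpleB_simpleB_apply,
    ← invOneLine_apply] at h

theorem invOneLine_simpleB_succ_mul_succ (j : Fin n) (w : BGroup (n + 1)) :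
    invOneLine (simpleB (n + 1) j.succ * w) (j + 1) = invOneLine w j := by
  have h := invOneLine_apply (simpleB (n + 1) j.succ * w) j.succ
  rwa [BGroup.inv_simpleB_mul_apply, simpleB_apply_pos_succ, ← invOneLine_apply] at h

theorem zero_mem_Des_iff {w : BGroup (n + 1)} :
    0 ∈ Des (simpleB (n + 1)) w ↔ invOneLine w 0 < 0 := by
  have h0 : invOneLine w 0 = (w⁻¹).1 (pos 0) := invOneLine_apply w 0
  rw [BGroup.mem_Des_iff, simpleB_apply_pos_zero, BGroup.apply_neg, ← Subtype.coe_lt_coe,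
    SignedSet.coe_neg, h0]
  omega

theorem succ_mem_Des_iff {j : Fin n} {w : BGroup (n + 1)} :
    j.succ ∈ Des (simpleB (n + 1)) w ↔ invOneLine w (j + 1) < invOneLine w j := by
  rw [BGroup.mem_Des_iff, simpleB_apply_pos_succ, ← Subtype.coe_lt_coe, ← invOneLine_apply,
    ← invOneLine_apply, Fin.val_succ, Fin.val_castSucc]

theorem invOneLine_demazure_zero (w : BGroup (n + 1)) :
    invOneLine (demazure (simpleB (n + 1)) 0 w) = sortAt 0 (invOneLine w) := by
  funext k
  simp only [sortAt]
  by_cases hw : 0 ∈ Des (simpleB (n + 1)) w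
  · rw [demazure_of_mem hw]
    rw [zero_mem_Des_iff] at hw
    grind
  · rw [demazure_of_notMem hw]
    rw [zero_mem_Des_iff] at hw
    by_cases hk : k = 0
    · rw [if_pos hk, hk, invOneLine_simpleB_zero_mul, min_eq_right (by omega)]
    · rw [if_neg hk, invOneLine_simpleB_mul_of_ne w (by simpa using hk) (by simp)]

theorem invOneLine_demazure_succ (j : Fin n) (w : BGroup (n + 1)) :
    invOneLine (demazure (simpleB (n + 1)) j.succ w) = sortAt (j + 1) (invOneLine w) := by
  funext k
  simp only [sortAt]
  by_cases hw : j.succ ∈ Des (simpleB (n + 1)) w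
  · rw [demazure_of_mem hw]
    rw [succ_mem_Des_iff] at hw
    grind
  · rw [demazure_of_notMem hw]
    rw [succ_mem_Des_iff, not_lt] at hw
    by_cases hkj : k = j
    · rw [if_pos hkj, hkj, invOneLine_simpleB_succ_mul_castSucc, max_eq_right hw]
    by_cases hkj' : k = j + 1
    · rw [if_neg hkj, if_pos hkj', hkj', invOneLine_simpleB_succ_mul_succ, min_eq_left hw]
    · rw [if_neg hkj, if_neg hkj', invOneLine_simpleB_mul_of_ne w hkj' (by simpa using hkj)]

theorem invOneLine_demazure (i : Fin n) (w : BGroup n) :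
    invOneLine (demazure (simpleB n) i w) = sortAt i (invOneLine w) := by
  obtain _ | n := n
  · exact i.elim0
  · exact Fin.cases (invOneLine_demazure_zero w) (fun j => invOneLine_demazure_succ j w) i

theorem demazure_demazure (i : Fin n) (w : BGroup n) :
    demazure (simpleB n) i (demazure (simpleB n) i w) = demazure (simpleB n) i w :=
  invOneLine_injective (by simp only [invOneLine_demazure, sortAt_sortAt])

theorem demazure_comm {i j : Fin n} (hij : (i : ℕ) + 2 ≤ j) (w : BGroup n) :
    demazure (simpleB n) i (demazure (simpleB n) j w) =
      demazure (simpleB n) j (demazure (simpleB n) i w) :=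
  invOneLine_injective (by simp only [invOneLine_demazure, sortAt_comm hij])

theorem demazure_braid {i j : Fin n} (hi : 1 ≤ (i : ℕ)) (hij : (j : ℕ) = i + 1) (w : BGroup n) :
    demazure (simpleB n) i (demazure (simpleB n) j (demazure (simpleB n) i w)) =
      demazure (simpleB n) j (demazure (simpleB n) i (demazure (simpleB n) j w)) := by
  obtain ⟨m, hm⟩ := Nat.exists_eq_add_of_le' hi
  exact invOneLine_injective (by simp only [invOneLine_demazure, hij, hm, sortAt_braid])

theorem demazure_braid_zero {i j : Fin n} (hi : (i : ℕ) = 0) (hj : (j : ℕ) = 1) (w : BGroup n) :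
    demazure (simpleB n) i (demazure (simpleB n) j
        (demazure (simpleB n) i (demazure (simpleB n) j w))) =
      demazure (simpleB n) j (demazure (simpleB n) i
        (demazure (simpleB n) j (demazure (simpleB n) i w))) :=
  invOneLine_injective (by simp only [invOneLine_demazure, hi, hj, sortAt_braid_zero])

end Sorting

/-! ### Modules over the 0-Hecke algebra and their classes -/

section HeckeModules

variable {n : ℕ}

theorem heckeB_induction {P : HeckeB n → Prop} (algebraMap : ∀ c, P (algebraMap ℂ (HeckeB n) c))
    (heckePi : ∀ i, P (heckePi n i)) (add : ∀ a b, P a → P b → P (a + b))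
    (mul : ∀ a b, P a → P b → P (a * b)) (h : HeckeB n) : P h := by
  obtain ⟨x, rfl⟩ := RingQuot.mkAlgHom_surjective ℂ (HeckeBRel n) h
  induction x using FreeAlgebra.induction with
  | grade0 c => simpa using algebraMap c
  | grade1 i => exact heckePi i
  | mul a b ha hb => simpa using mul _ _ ha hb
  | add a b ha hb => simpa using add _ _ ha hb

theorem exists_heckeModule_neg {M : Type*} [AddCommGroup M] [Module ℂ M]
    (T : Fin n → Module.End ℂ M)
    (sq : ∀ i, T i * T i = T i)
    (comm : ∀ i j : Fin n, (i : ℕ) + 2 ≤ j → T i * T j = T j * T i)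
    (braid : ∀ i j : Fin n, 1 ≤ (i : ℕ) → (j : ℕ) = i + 1 → T i * T j * T i = T j * T i * T j)
    (braid_zero : ∀ i j : Fin n, (i : ℕ) = 0 → (j : ℕ) = 1 →
      T i * T j * T i * T j = T j * T i * T j * T i) :
    ∃ (_ : Module (HeckeB n) M) (_ : IsScalarTower ℂ (HeckeB n) M),
      ∀ (i : Fin n) (v : M), heckePi n i • v = -T i v := by
  let φ : HeckeB n →ₐ[ℂ] Module.End ℂ M :=
    RingQuot.liftAlgHom ℂ ⟨FreeAlgebra.lift ℂ fun i => -T i, by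
      intro x y h
      induction h with
      | sq i => simpa using sq i
      | comm i j h => simpa using comm i j h
      | braid i j hi h => simpa using braid i j hi h
      | braid_zero i j hi hj => simpa using braid_zero i j hi hj⟩
  let _ : Module (HeckeB n) M := Module.compHom M φ.toRingHom
  have smul_def (h : HeckeB n) (v : M) : h • v = φ h v := rfl
  refine ⟨inferInstance, ⟨fun c h v => ?_⟩, fun i v => ?_⟩
  · rw [smul_def, smul_def, map_smul, LinearMap.smul_apply]
  · simp [smul_def, φ, heckePi, RingQuot.liftAlgHom_mkAlgHom_apply]

section Classes

variable {A B C : Type}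
  [AddCommGroup A] [Module ℂ A] [Module (HeckeB n) A] [IsScalarTower ℂ (HeckeB n) A]
  [Module.Finite ℂ A]
  [AddCommGroup B] [Module ℂ B] [Module (HeckeB n) B] [IsScalarTower ℂ (HeckeB n) B]
  [Module.Finite ℂ B]
  [AddCommGroup C] [Module ℂ C] [Module (HeckeB n) C] [IsScalarTower ℂ (HeckeB n) C]
  [Module.Finite ℂ C]

theorem grothendieckClass_of_exact (f : A →ₗ[HeckeB n] B) (g : B →ₗ[HeckeB n] C)
    (hf : Function.Injective f) (hfg : Function.Exact f g) (hg : Function.Surjective g) :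
    grothendieckClass n B = grothendieckClass n A + grothendieckClass n C := by
  have hrel : grothendieckClass n A - grothendieckClass n B + grothendieckClass n C = 0 :=
    (QuotientAddGroup.eq_zero_iff _).2 <| AddSubgroup.subset_closure
      ⟨HeckeMod.mk A, HeckeMod.mk B, HeckeMod.mk C, f, g, hf, hfg, hg, rfl⟩
  rwa [sub_add_eq_add_sub, sub_eq_zero, eq_comm] at hrel

theorem grothendieckClass_of_subsingleton [Subsingleton A] : grothendieckClass n A = 0 :=
  left_eq_add.1 <| grothendieckClass_of_exact (LinearMap.id : A →ₗ[HeckeB n] A)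
    (LinearMap.id : A →ₗ[HeckeB n] A) Function.injective_id
    (fun x => ⟨fun _ => ⟨x, rfl⟩, fun _ => Subsingleton.elim _ _⟩) Function.surjective_id

theorem grothendieckClass_congr (e : A ≃ₗ[HeckeB n] B) :
    grothendieckClass n A = grothendieckClass n B := by
  have hB := grothendieckClass_of_exact (e : A →ₗ[HeckeB n] B) (0 : B →ₗ[HeckeB n] PUnit)
    e.injective (fun y => ⟨fun _ => e.surjective y, fun _ => rfl⟩) (fun _ => ⟨0, rfl⟩)
  rw [hB, grothendieckClass_of_subsingleton (A := PUnit), add_zero]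

theorem grothendieckClass_prod :
    grothendieckClass n (A × B) = grothendieckClass n A + grothendieckClass n B :=
  grothendieckClass_of_exact (LinearMap.inl (HeckeB n) A B) (LinearMap.snd (HeckeB n) A B)
    LinearMap.inl_injective Function.Exact.inl_snd LinearMap.snd_surjective

theorem grothendieckClass_pi {κ : Type} [Fintype κ] (V : κ → Type) [∀ i, AddCommGroup (V i)]
    [∀ i, Module ℂ (V i)] [∀ i, Module (HeckeB n) (V i)] [∀ i, IsScalarTower ℂ (HeckeB n) (V i)]
    [∀ i, Module.Finite ℂ (V i)] :
    grothendieckClass n (∀ i, V i) = ∑ i, grothendieckClass n (V i) := by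
  revert V
  refine Fintype.induction_empty_option (P := fun κ [Fintype κ] => ∀ (V : κ → Type)
    [∀ i, AddCommGroup (V i)] [∀ i, Module ℂ (V i)] [∀ i, Module (HeckeB n) (V i)]
    [∀ i, IsScalarTower ℂ (HeckeB n) (V i)] [∀ i, Module.Finite ℂ (V i)],
    grothendieckClass n (∀ i, V i) = ∑ i, grothendieckClass n (V i)) ?_ ?_ ?_ κ
  · intro α β _ e ih V _ _ _ _ _
    let _ := Fintype.ofEquiv β e.symm
    rw [← Equiv.sum_comp e, ← ih fun a => V (e a)]
    exact (grothendieckClass_congr (LinearEquiv.piCongrLeft (HeckeB n) V e)).symm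
  · intro V _ _ _ _ _
    rw [Finset.univ_eq_empty, Finset.sum_empty, grothendieckClass_of_subsingleton]
  · intro α _ ih V _ _ _ _ _
    let e : (∀ i, V i) ≃ₗ[HeckeB n] V none × ∀ a, V (some a) :=
      { Equiv.piOptionEquivProd with map_add' := fun _ _ => rfl, map_smul' := fun _ _ => rfl }
    rw [Fintype.sum_option, ← ih fun a => V (some a), ← grothendieckClass_prod,
      grothendieckClass_congr e]

theorem chB_directSum {κ : Type} [Fintype κ] (V : κ → Type) [∀ i, AddCommGroup (V i)]
    [∀ i, Module ℂ (V i)] [∀ i, Module (HeckeB n) (V i)] [∀ i, IsScalarTower ℂ (HeckeB n) (V i)]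
    [∀ i, Module.Finite ℂ (V i)] : chB n (⨁ i, V i) = ∑ i, chB n (V i) := by
  classical
  rw [chB, grothendieckClass_congr (DirectSum.linearEquivFunOnFintype (HeckeB n) κ V),
    grothendieckClass_pi, map_sum]
  rfl

instance finite_heckeSubmodule (p : Submodule (HeckeB n) A) : Module.Finite ℂ p :=
  inferInstanceAs (Module.Finite ℂ (p.restrictScalars ℂ))

end Classes

section Triangular

variable {X : Type} [Module (HeckeB n) (X →₀ ℂ)]

variable (n) in
/-- `H_n^B(0)` acts on `ℂX` triangularly with respect to the rank `r`, with the characters of the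
sets `I x` on the diagonal: in the coordinate `x` of `h • v`, only the coordinates of `v` of rank
less than `r x` and the coordinate `x` itself contribute. -/
def IsTriangular (I : X → Set (Fin n)) (r : X → ℕ) : Prop :=
  ∀ (h : HeckeB n) (v : X →₀ ℂ) (x : X), (∀ y, r y < r x → v y = 0) →
    (h • v) x = heckeChar n (I x) h * v x

theorem isTriangular_of_heckePi [IsScalarTower ℂ (HeckeB n) (X →₀ ℂ)] {I : X → Set (Fin n)}
    {r : X → ℕ} (hpi : ∀ (i : Fin n) (v : X →₀ ℂ) (x : X), (∀ y, r y < r x → v y = 0) →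
      (heckePi n i • v) x = heckeChar n (I x) (heckePi n i) * v x) :
    IsTriangular n I r := by
  intro h
  induction h using heckeB_induction with
  | algebraMap c =>
    intro v x _
    rw [algebraMap_smul, Finsupp.smul_apply, AlgHom.commutes, Algebra.algebraMap_self_apply,
      smul_eq_mul]
  | heckePi i => exact hpi i
  | add a b ha hb =>
    intro v x hv
    rw [add_smul, Finsupp.add_apply, ha v x hv, hb v x hv, map_add, add_mul]
  | mul a b ha hb =>
    intro v x hv
    have hbv (y : X) (hy : r y < r x) : (b • v) y = 0 := by
      rw [hb v y fun z hz => hv z (hz.trans hy), hv y hy, mul_zero]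
    rw [mul_smul, ha _ x hbv, hb v x hv, map_mul, mul_assoc]

namespace IsTriangular

variable {I : X → Set (Fin n)} {r : X → ℕ}

/-- The filtration of a triangular module `ℂX` by the rank of the elements of `X`. -/
def filtration (hX : IsTriangular n I r) (k : ℕ) : Submodule (HeckeB n) (X →₀ ℂ) where
  carrier := {v | ∀ x, r x < k → v x = 0}
  add_mem' hv hw x hx := by rw [Finsupp.add_apply, hv x hx, hw x hx, add_zero]
  zero_mem' _ _ := rfl
  smul_mem' h v hv x hx := by rw [hX h v x fun y hy => hv y (hy.trans hx), hv x hx, mul_zero]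

/-- The coordinates of rank `k`, which identify the `k`-th graded piece of the filtration with a
sum of simple modules. -/
def gradedMap (hX : IsTriangular n I r) (k : ℕ) :
    hX.filtration k →ₗ[HeckeB n] ∀ x : {x // r x = k}, SimpleMod n (I x) where
  toFun v x := (v : X →₀ ℂ) x
  map_add' _ _ := rfl
  map_smul' h v := funext fun x => hX h v x fun y hy => v.2 y (hy.trans_eq x.2)

theorem gradedMap_surjective [Finite X] (hX : IsTriangular n I r) (k : ℕ) :
    Function.Surjective (hX.gradedMap k) := by
  intro c
  let v : X →₀ ℂ := Finsupp.equivFunOnFinite.symm fun x => if h : r x = k then c ⟨x, h⟩ else 0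
  refine ⟨⟨v, fun x hx => dif_neg hx.ne⟩, funext fun x => ?_⟩
  exact dif_pos x.2

theorem filtration_succ_le (hX : IsTriangular n I r) (k : ℕ) :
    hX.filtration (k + 1) ≤ hX.filtration k :=
  fun _ hv x hx => hv x (hx.trans k.lt_succ_self)

theorem exact_inclusion_gradedMap (hX : IsTriangular n I r) (k : ℕ) :
    Function.Exact (Submodule.inclusion (hX.filtration_succ_le k)) (hX.gradedMap k) := by
  intro v
  rw [← LinearMap.coe_range, SetLike.mem_coe, Submodule.range_inclusion]
  change _ ↔ ∀ x, r x < k + 1 → (v : X →₀ ℂ) x = 0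
  constructor
  · intro hv x hx
    rcases (Nat.lt_succ_iff.1 hx).lt_or_eq with hlt | heq
    · exact v.2 x hlt
    · exact congrFun hv ⟨x, heq⟩
  · exact fun hv => funext fun x => hv x (Nat.lt_succ_of_le x.2.le)

variable [Fintype X] [IsScalarTower ℂ (HeckeB n) (X →₀ ℂ)]

theorem grothendieckClass_eq_sum (hX : IsTriangular n I r) :
    grothendieckClass n (X →₀ ℂ) = ∑ x, grothendieckClass n (SimpleMod n (I x)) := by
  set K := Finset.univ.sup r + 1
  have hK (x : X) : r x < K := Nat.lt_succ_of_le (Finset.le_sup (Finset.mem_univ x))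
  have class_top : grothendieckClass n (X →₀ ℂ) = grothendieckClass n (hX.filtration 0) :=
    (grothendieckClass_congr <| LinearEquiv.ofTop _ <| eq_top_iff.2 fun _ _ _ hx =>
      absurd hx (Nat.not_lt_zero _)).symm
  have class_bot : grothendieckClass n (hX.filtration K) = 0 := by
    have : Subsingleton (hX.filtration K) := ⟨fun v w => Subtype.ext <| Finsupp.ext fun x => by
      rw [v.2 x (hK x), w.2 x (hK x)]⟩
    exact grothendieckClass_of_subsingleton
  have class_graded (k : ℕ) :
      grothendieckClass n (hX.filtration k) - grothendieckClass n (hX.filtration (k + 1)) =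
        ∑ x with r x = k, grothendieckClass n (SimpleMod n (I x)) := by
    rw [grothendieckClass_of_exact (A := hX.filtration (k + 1)) (B := hX.filtration k)
      (Submodule.inclusion (hX.filtration_succ_le k)) (hX.gradedMap k)
      (Submodule.inclusion_injective (hX.filtration_succ_le k))
      (hX.exact_inclusion_gradedMap k) (hX.gradedMap_surjective k), add_sub_cancel_left,
      grothendieckClass_pi, Finset.sum_subtype (p := fun x => r x = k) _ (by simp)]
  rw [class_top, ← sub_zero (grothendieckClass n (hX.filtration 0)), ← class_bot,
    ← Finset.sum_range_sub' (fun k => grothendieckClass n (hX.filtration k)),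
    ← Finset.sum_fiberwise_of_maps_to (t := Finset.range K) (g := r)
    fun x _ => Finset.mem_range.2 (hK x)]
  exact Finset.sum_congr rfl fun k _ => class_graded k

theorem chB_eq_sum (hX : IsTriangular n I r) : chB n (X →₀ ℂ) = ∑ x, fundB n (I x) := by
  rw [chB, hX.grothendieckClass_eq_sum, map_sum]
  exact Finset.sum_congr rfl fun x _ => chHom_simple n (I x)

end IsTriangular

end Triangular

end HeckeModules

/-! ### Weak order modules -/

namespace IsInversionCocycle

variable {ι G : Type*} [Group G] [DecidableEq G] {s : ι → G} {N : G → Finset G}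
  (hN : IsInversionCocycle s N)
include hN

open Classical in
theorem piOp_single_one_apply (X : Set G) (i : ι) {x y : X}
    (hxy : wordLength s (x : G) ≤ wordLength s (y : G)) :
    piOp s X i (Finsupp.single y 1) x =
      (if i ∈ Des s (x : G) then -1 else 0) * (Finsupp.single y 1 : X →₀ ℂ) x := by
  rw [piOp_single_one]
  by_cases hi : i ∈ Des s (y : G)
  · rw [if_pos hi, Finsupp.neg_apply]
    obtain rfl | hne := eq_or_ne y x
    · rw [if_pos hi, neg_one_mul]
    · rw [Finsupp.single_eq_of_ne' hne, neg_zero, mul_zero]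
  · have hright : (if i ∈ Des s (x : G) then -1 else 0) * (Finsupp.single y 1 : X →₀ ℂ) x = 0 := by
      obtain rfl | hne := eq_or_ne y x
      · rw [if_neg hi, zero_mul]
      · rw [Finsupp.single_eq_of_ne' hne, mul_zero]
    rw [if_neg hi, hright]
    split_ifs with h
    · refine Finsupp.single_eq_of_ne' ?_
      rintro rfl
      rw [hN.wordLength_simple_mul hi] at hxy
      exact absurd hxy (Nat.not_succ_le_self _)
    · rfl

open Classical in
theorem piOp_apply (X : Set G) (i : ι) {v : X →₀ ℂ} {x : X}
    (hv : ∀ y : X, wordLength s (y : G) < wordLength s (x : G) → v y = 0) :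
    piOp s X i v x = (if i ∈ Des s (x : G) then -1 else 0) * v x := by
  have hspan : v ∈ Submodule.span ℂ ((fun y => Finsupp.single y 1) ''
      {y : X | wordLength s (x : G) ≤ wordLength s (y : G)}) := by
    rw [← Finsupp.supported_eq_span_single, Finsupp.mem_supported']
    exact fun y hy => hv y (not_le.1 hy)
  refine LinearMap.eqOn_span (f := Finsupp.lapply x ∘ₗ piOp s X i)
    (g := (if i ∈ Des s (x : G) then (-1 : ℂ) else 0) • Finsupp.lapply x) ?_ hspan
  rintro _ ⟨y, hy, rfl⟩
  exact hN.piOp_single_one_apply X i hy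

end IsInversionCocycle

theorem IsInversionCocycle.chB_eq_finsum {n : ℕ} {G : Type} [Group G] [DecidableEq G]
    {s : Fin n → G} {N : G → Finset G} (hN : IsInversionCocycle s N) (X : Set G) [Finite X]
    [Module (HeckeB n) (X →₀ ℂ)] [IsScalarTower ℂ (HeckeB n) (X →₀ ℂ)]
    (hpi : ∀ (i : Fin n) (v : X →₀ ℂ), heckePi n i • v = piOp s X i v) :
    chB n (X →₀ ℂ) = ∑ᶠ x ∈ X, fundB n (Des s x) := by
  have := Fintype.ofFinite X
  have triangular : IsTriangular n (fun x : X => Des s (x : G)) fun x => wordLength s (x : G) :=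
    isTriangular_of_heckePi fun i v x hv => by rw [hpi, heckeChar_pi, hN.piOp_apply X i hv]
  rw [triangular.chB_eq_sum, ← finsum_eq_sum_of_fintype,
    finsum_set_coe_eq_finsum_mem (f := fun x => fundB n (Des s x))]

section TypeB

variable {n : ℕ}

open BGroup

open Classical in
theorem exists_heckeModule_invClass (C D : Set (BGroup n)) :
    ∃ (_ : Module (HeckeB n) (invClass inversions C D →₀ ℂ))
      (_ : IsScalarTower ℂ (HeckeB n) (invClass inversions C D →₀ ℂ)),
      ∀ (i : Fin n) (v : invClass inversions C D →₀ ℂ),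
        heckePi n i • v = piOp (simpleB n) (invClass inversions C D) i v := by
  have prod_eq {ω ω' : List (Fin n)} :=
    (isInversionCocycle_inversions (n := n)).prod_neg_piOp_eq_of_foldr_demazure_eq C D
      (ω := ω) (ω' := ω')
  obtain ⟨hmodule, htower, hpi⟩ := exists_heckeModule_neg
    (fun i => -piOp (simpleB n) (invClass inversions C D) i)
    (fun i => by simpa using prod_eq (ω := [i, i]) (ω' := [i]) (demazure_demazure i))
    (fun i j hij => by simpa using prod_eq (ω := [i, j]) (ω' := [j, i]) (demazure_comm hij))
    (fun i j hi hij => by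
      simpa [mul_assoc] using
        prod_eq (ω := [i, j, i]) (ω' := [j, i, j]) (demazure_braid hi hij))
    (fun i j hi hj => by
      simpa [mul_assoc] using
        prod_eq (ω := [i, j, i, j]) (ω' := [j, i, j, i]) (demazure_braid_zero hi hj))
  exact ⟨hmodule, htower, fun i v => by rw [hpi, LinearMap.neg_apply, neg_neg]⟩

theorem QB_eq_finsum_inv (X : Set (BGroup n)) :
    QB n X = ∑ᶠ x ∈ X⁻¹, fundB n (Des (simpleB n) x) := by
  refine finsum_mem_eq_of_bijOn (·⁻¹) ⟨fun x hx => ?_, inv_injective.injOn, fun x hx => ?_⟩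
    fun _ _ => rfl
  · exact Set.inv_mem_inv.2 hx
  · exact ⟨x⁻¹, hx, inv_inv x⟩

open Classical in
theorem exists_heckeModule_of_inv_eq_invClass {X C D : Set (BGroup n)}
    (hX : X⁻¹ = invClass inversions C D) :
    ∃ (_ : Module (HeckeB n) (↥X⁻¹ →₀ ℂ)) (_ : IsScalarTower ℂ (HeckeB n) (↥X⁻¹ →₀ ℂ)),
      (∀ (j : Fin n) (v : ↥X⁻¹ →₀ ℂ), heckePi n j • v = piOp (simpleB n) X⁻¹ j v) ∧
      chB n (↥X⁻¹ →₀ ℂ) = QB n X := by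
  rw [QB_eq_finsum_inv, hX]
  obtain ⟨hmodule, htower, hpi⟩ := exists_heckeModule_invClass C D
  exact ⟨hmodule, htower, hpi, isInversionCocycle_inversions.chB_eq_finsum _ hpi⟩

theorem pairwise_disjoint_leftUnimodalClass :
    Pairwise (Function.onFun Disjoint (leftUnimodalClass n)) := by
  refine (Std.Symm.pairwise_on _).2 ?_
  intro i j hij
  rw [Set.disjoint_left]
  rintro σ ⟨-, increasing⟩ ⟨decreasing, -⟩
  exact lt_asymm (increasing Set.self_mem_Ici hij.le hij) (decreasing hij.le Set.self_mem_Iic hij)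

theorem QB_leftUnimodal : QB n (leftUnimodal n) = ∑ i, QB n (leftUnimodalClass n i) := by
  rw [QB, leftUnimodal, finsum_mem_iUnion pairwise_disjoint_leftUnimodalClass
    fun _ => Set.toFinite _, finsum_eq_sum_of_fintype]
  rfl

end TypeB

theorem mainTheorem12 (n : ℕ) :
    -- inverses of left descent classes and of the classes `L_i^B` are ascent-compatible
    (∀ I : Set (Fin n), AscentCompatible (simpleB n) (descentClass (simpleB n) I)⁻¹) ∧
    (∀ i : Fin n, AscentCompatible (simpleB n) (leftUnimodalClass n i)⁻¹) ∧
    -- the latter are explicit intervals in the left weak order (positions are shifted by one)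
    (∀ i : Fin n, ∃ τ σ : BGroup n,
      (∀ j : Fin n, (τ.1 (pos j) : ℤ) =
        if j ≤ i then ((i : ℤ) + 1) + 1 - ((j : ℤ) + 1) else (j : ℤ) + 1) ∧
      (∀ j : Fin n, (σ.1 (pos j) : ℤ) =
        if j < i then -((j : ℤ) + 1) else ((j : ℤ) + 1) - ((i : ℤ) + 1) - (n : ℤ)) ∧
      LeftWeakLE (simpleB n) τ σ ∧
      (leftUnimodalClass n i)⁻¹ = leftInterval (simpleB n) τ σ) ∧
    -- the modules of the descent classes and their characteristics
    (∀ I : Set (Fin n),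
      ∃ (_ : Module (HeckeB n) (↥(descentClass (simpleB n) I)⁻¹ →₀ ℂ))
        (_ : IsScalarTower ℂ (HeckeB n) (↥(descentClass (simpleB n) I)⁻¹ →₀ ℂ)),
        (∀ (j : Fin n) (v : ↥(descentClass (simpleB n) I)⁻¹ →₀ ℂ),
          heckePi n j • v = piOp (simpleB n) (descentClass (simpleB n) I)⁻¹ j v) ∧
        chB n (↥(descentClass (simpleB n) I)⁻¹ →₀ ℂ) = QB n (descentClass (simpleB n) I)) ∧
    -- the modules of the classes `L_i^B`, their characteristics, and that of their direct sum
    (∃ (_ : ∀ i : Fin n, Module (HeckeB n) (↥(leftUnimodalClass n i)⁻¹ →₀ ℂ))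
       (_ : ∀ i : Fin n, IsScalarTower ℂ (HeckeB n) (↥(leftUnimodalClass n i)⁻¹ →₀ ℂ)),
       (∀ (i j : Fin n) (v : ↥(leftUnimodalClass n i)⁻¹ →₀ ℂ),
          heckePi n j • v = piOp (simpleB n) (leftUnimodalClass n i)⁻¹ j v) ∧
       (∀ i : Fin n, chB n (↥(leftUnimodalClass n i)⁻¹ →₀ ℂ) = QB n (leftUnimodalClass n i)) ∧
       chB n (⨁ i : Fin n, (↥(leftUnimodalClass n i)⁻¹ →₀ ℂ)) = QB n (leftUnimodal n)) := by
  classical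
  have cocycle := BGroup.isInversionCocycle_inversions (n := n)
  have descent_eq := cocycle.inv_descentClass_eq_invClass simpleB_injective
  have unimodal_eq (i : Fin n) := (inv_leftUnimodalClass_eq i).trans
    (cocycle.leftInterval_eq_invClass (unimodalMin_le_unimodalMax i))
  refine ⟨fun I => ?_, fun i => ?_, fun i => ?_, fun I => ?_, ?_⟩
  · rw [descent_eq]
    exact cocycle.ascentCompatible_invClass _ _
  · rw [unimodal_eq]
    exact cocycle.ascentCompatible_invClass _ _
  · exact ⟨unimodalMin i, unimodalMax i, coe_unimodalMin_apply_pos i, coe_unimodalMax_apply_pos i,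
      unimodalMin_le_unimodalMax i, inv_leftUnimodalClass_eq i⟩
  · exact exists_heckeModule_of_inv_eq_invClass (descent_eq I)
  · choose hmodule htower hpi hch using
      fun i : Fin n => exists_heckeModule_of_inv_eq_invClass (unimodal_eq i)
    refine ⟨hmodule, htower, hpi, hch, ?_⟩
    rw [QB_leftUnimodal, chB_directSum]
    exact Finset.sum_congr rfl fun i _ => hch i
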